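/- Let $p$ be a fixed prime and $r\ge 1$ a fixed integer. For $n\ge 1$ let $q=p^n$, and for $d\ge 1$ prime to $p$ let $\mathcal{G}_d$ be the set of monic polynomials of degree $d$ in $\mathbb{F}_q[x]$. For $f\in\mathcal{G}_d$ let $C_f$ be the normalisation of the projective closure of the affine curve $y^p-y=f(x)$ over $\mathbb{F}_q$, and put $$N(f)=\frac{\#C_f(\mathbb{F}_{q^r})-1}{p}.$$ Let $f$ be chosen uniformly at random from $\mathcal{G}_d$, and let $n$ and $d$ both tend to infinity, independently of each other, with $d$ prime to $p$. (i) If $\gcd(r,p)=1$ or $p>2$, then $$p^{1/2}\left(\left(1-\tfrac1p\right)r\right)^{-1/2}q^{-r/2}\left(N(f)-\frac{q^r}{p}\right)$$ converges in distribution to the Gaussian distribution with mean $0$ and variance $1$. (ii) If $p=2$ and $r$ is even, then $$2\,r^{-1/2}q^{-r/2}\left(N(f)-\frac{q^r}{p}-\frac{q^{r/2}}{2}\right)$$ converges in distribution to the Gaussian distribution with mean $0$ and variance $1$. -/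

import Mathlib

open Polynomial Filter MeasureTheory ProbabilityTheory

noncomputable section

namespace ArtinSchreier

section Curve

variable (p : ℕ) {K : Type*} [Field K]

/-- The polynomial `Y ^ p - Y - f(x)` in the variable `Y`, over the field `K(x)`. -/
def equation (f : K[X]) : (RatFunc K)[X] :=
  X ^ p - X - C (algebraMap K[X] (RatFunc K) f)

/-- If `b ^ p - b = a` has no solution in a field `k` of characteristic `p`, then
`Y ^ p - Y - a` is irreducible over `k`. -/
theorem irreducible_of_no_root {k : Type*} [Field k] [Fact p.Prime] [CharP k p] (a : k)
    (h : ∀ b : k, b ^ p - b ≠ a) : Irreducible (X ^ p - X - C a : k[X]) := by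
  have hp : p.Prime := Fact.out
  have hdeg : (X ^ p - X - C a : k[X]).natDegree = p := by
    rw [natDegree_sub_C, FiniteField.X_pow_card_sub_X_natDegree_eq _ hp.one_lt]
  have hmon : (X ^ p - X - C a : k[X]).Monic := by
    have h1 : (X ^ p - X - C a : k[X]) = X ^ p - (X + C a) := by ring
    rw [h1]
    refine monic_X_pow_sub ?_
    rw [degree_X_add_C]
    exact_mod_cast hp.one_lt
  obtain ⟨g, hgm, hgi, hgd⟩ := exists_monic_irreducible_factor (X ^ p - X - C a : k[X])
    (fun hu => by
      have := natDegree_eq_zero_of_isUnit hu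
      rw [hdeg] at this
      exact hp.ne_zero this)
  let E := AlgebraicClosure k
  have : CharP E p := charP_of_injective_algebraMap (algebraMap k E).injective p
  have hsp : (g.map (algebraMap k E)).Splits := IsAlgClosed.splits _
  have hgm' : (g.map (algebraMap k E)).Monic := hgm.map _
  have hroot : ∀ z ∈ (g.map (algebraMap k E)).roots, z ^ p - z = algebraMap k E a := by
    intro z hz
    have hz' := (mem_roots'.1 hz).2
    have h2 := (hz'.dvd (Polynomial.map_dvd (algebraMap k E) hgd))
    simp only [IsRoot.def, Polynomial.map_sub, Polynomial.map_pow, map_X, map_C, eval_sub,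
      eval_pow, eval_X, eval_C] at h2
    exact sub_eq_zero.1 h2
  have hge : g.natDegree ≤ p := hdeg ▸ natDegree_le_of_dvd hgd hmon.ne_zero
  have hcard : (g.map (algebraMap k E)).roots.card = g.natDegree := by
    rw [← hsp.natDegree_eq_card_roots, natDegree_map]
  by_cases hlt : g.natDegree < p
  · exfalso
    have hpos : 0 < g.natDegree := hgi.natDegree_pos
    obtain ⟨y, hy⟩ := Multiset.card_pos_iff_exists_mem.1 (hcard ▸ hpos)
    have hprime : ∀ z ∈ (g.map (algebraMap k E)).roots, ∃ n : ℤ, (n : E) = z - y := by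
      intro z hz
      rw [← mem_bot_iff_intCast p E, Subfield.mem_bot_iff_pow_eq_self E p, sub_pow_char]
      have := (hroot z hz).trans (hroot y hy).symm
      linear_combination this
    have hsum : ∀ s : Multiset E, (∀ z ∈ s, ∃ n : ℤ, (n : E) = z - y) →
        ∃ n : ℤ, s.sum = s.card * y + n := by
      intro s
      induction s using Multiset.induction with
      | empty => intro _; exact ⟨0, by simp⟩
      | cons z s ih =>
        intro hs
        obtain ⟨n, hn⟩ := ih (fun w hw => hs w (Multiset.mem_cons_of_mem hw))
        obtain ⟨m, hm⟩ := hs z (Multiset.mem_cons_self z s)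
        refine ⟨n + m, ?_⟩
        rw [Multiset.sum_cons, Multiset.card_cons, hn]
        push_cast
        linear_combination -hm
    obtain ⟨n, hn⟩ := hsum _ hprime
    rw [hcard] at hn
    have hnext := hsp.nextCoeff_eq_neg_sum_roots_of_monic hgm'
    rw [nextCoeff_map (algebraMap k E).injective, hn] at hnext
    have hne : (g.natDegree : k) ≠ 0 := by
      rw [Ne, CharP.cast_eq_zero_iff k p]
      exact Nat.not_dvd_of_pos_of_lt hpos hlt
    have hne' : (g.natDegree : E) ≠ 0 := by
      rw [Ne, CharP.cast_eq_zero_iff E p]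
      exact Nat.not_dvd_of_pos_of_lt hpos hlt
    have hyk : y = algebraMap k E ((-g.nextCoeff - n) / g.natDegree) := by
      rw [map_div₀, map_sub, map_neg, map_natCast, map_intCast, hnext, eq_div_iff hne']
      ring
    refine h ((-g.nextCoeff - n) / g.natDegree) ((algebraMap k E).injective ?_)
    rw [map_sub, map_pow, ← hyk]
    exact hroot y hy
  · have heq : X ^ p - X - C a = g :=
      eq_of_monic_of_dvd_of_natDegree_le hgm hmon hgd (by rw [hdeg]; omega)
    rw [heq]
    exact hgi

/-- For `f` of degree prime to `p`, the equation `Y ^ p - Y = f(x)` is irreducible over `K(x)`. -/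
theorem irreducible_equation [Fact p.Prime] [CharP K p] (f : K[X])
    (hf : f.natDegree.Coprime p) : Irreducible (equation p f) := by
  have hp : p.Prime := Fact.out
  refine irreducible_of_no_root p _ fun b hb => ?_
  have hint : IsIntegral K[X] b := by
    refine ⟨X ^ p - (X + C f), monic_X_pow_sub ?_, ?_⟩
    · rw [degree_X_add_C]
      exact_mod_cast hp.one_lt
    · simp only [eval₂_sub, eval₂_pow, eval₂_X, eval₂_add, eval₂_C]
      rw [← hb]
      ring
  obtain ⟨g, rfl⟩ := IsIntegrallyClosed.isIntegral_iff.1 hint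
  have hg : g ^ p - g = f := by
    apply IsFractionRing.injective K[X] (RatFunc K)
    rw [map_sub, map_pow, hb]
  have hdvd : p ∣ f.natDegree := by
    rcases Nat.eq_zero_or_pos g.natDegree with h0 | h0
    · have : f.natDegree = 0 := by
        rw [eq_C_of_natDegree_eq_zero h0, ← C_pow, ← C_sub] at hg
        rw [← hg, natDegree_C]
      rw [this]
      exact dvd_zero p
    · have : f.natDegree = p * g.natDegree := by
        rw [← hg, natDegree_sub_eq_left_of_natDegree_lt, natDegree_pow]
        rw [natDegree_pow]
        exact lt_mul_of_one_lt_left h0 hp.one_lt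
      rw [this]
      exact dvd_mul_right _ _
  exact hp.one_lt.ne' (Nat.dvd_one.1 (hf ▸ Nat.dvd_gcd hdvd dvd_rfl))

/-- A place of degree one of a function field `L` over `K`: a valuation ring of `L` which contains
`K`, is different from `L`, and whose residue field is `K`. When `L` is the function field of a
geometrically integral normal projective curve over `K`, these are the `K`-rational points of the
curve, a point corresponding to its local ring. -/
structure RationalPlace (K L : Type*) [Field K] [Field L] [Algebra K L] where
  ring : ValuationSubring L
  algebraMap_mem : ∀ c : K, algebraMap K L c ∈ ring
  ne_top : ring ≠ ⊤
  residue : ∀ u : ring, ∃ c : K, IsLocalRing.residue ring u =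
    IsLocalRing.residue ring ⟨algebraMap K L c, algebraMap_mem c⟩

open Classical in
/-- The number of `K`-rational points of the normalisation of the projective closure of the affine
curve `y ^ p - y = f(x)` over `K`, whose function field is `K(x)[Y] / (Y ^ p - Y - f(x))`.
The curve is only considered when the equation is irreducible, which is so whenever `K` has
characteristic `p` and the degree of `f` is prime to `p`; otherwise the value is `0`. -/
def numPoints (f : K[X]) : ℕ :=
  if h : Irreducible (equation p f) then
    haveI : Fact (Irreducible (equation p f)) := ⟨h⟩
    Nat.card (RationalPlace K (AdjoinRoot (equation p f)))
  else 0

end Curve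

/-- `N(f) = (#C_f(E) - 1) / p`, where `C_f` is the curve `y ^ p - y = f(x)` over `F` and `E` is an
extension of `F`. -/
def normCount (p : ℕ) {F : Type*} (E : Type*) [Field F] [Field E] [Algebra F E] (f : F[X]) : ℝ :=
  ((numPoints p (f.map (algebraMap F E)) : ℝ) - 1) / p

/-- The monic polynomials of degree `d` over `F`. -/
def MonicOfDegree (F : Type*) [Field F] (d : ℕ) : Type _ :=
  {f : F[X] // f.Monic ∧ f.natDegree = d}

instance (F : Type*) [Field F] (d : ℕ) : Nonempty (MonicOfDegree F d) :=
  ⟨⟨X ^ d, monic_X_pow d, natDegree_X_pow d⟩⟩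

instance (F : Type*) [Field F] [Finite F] (d : ℕ) : Finite (MonicOfDegree F d) := by
  refine Finite.of_injective
    (fun (f : MonicOfDegree F d) (i : Fin (d + 1)) => f.1.coeff (i : ℕ)) ?_
  rintro ⟨f, hf, hfd⟩ ⟨g, hg, hgd⟩ hfg
  refine Subtype.ext (Polynomial.ext fun i => ?_)
  by_cases hi : i < d + 1
  · exact congrFun hfg ⟨i, hi⟩
  · change f.coeff i = g.coeff i
    rw [coeff_eq_zero_of_natDegree_lt (by omega), coeff_eq_zero_of_natDegree_lt (by omega)]

instance (F : Type*) [Field F] (d : ℕ) : MeasurableSpace (MonicOfDegree F d) := ⊤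

/-- The variable `N(f)` for the extension of degree `r` of the field with `p ^ n` elements, on the
monic polynomials `f` of degree `d` over the latter field. -/
def N (p r : ℕ) [Fact p.Prime] [NeZero r] (n d : ℕ) (f : MonicOfDegree (GaloisField p n) d) : ℝ :=
  normCount p (FiniteField.Extension (GaloisField p n) p r) f.1

/-- The uniform distribution on the monic polynomials of degree `d` over the field with `p ^ n`
elements. -/
def uniform (p : ℕ) [Fact p.Prime] (n d : ℕ) : Measure (MonicOfDegree (GaloisField p n) d) :=
  uniformOn Set.univ

instance (p : ℕ) [Fact p.Prime] (n d : ℕ) : IsProbabilityMeasure (uniform p n d) :=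
  inferInstanceAs (IsProbabilityMeasure (uniformOn Set.univ))

end ArtinSchreier

end

/-! Let `F` have `q` elements and let `E` be its extension of degree `r`. The function field of the
curve has one place over `x = ∞`, totally ramified because the degree `d` of `f` is prime to `p`. It
also has exactly one rational place centred at each affine solution, because `∂/∂y (y ^ p - y) = -1`
makes the affine curve smooth (`IsGenericPoint.card_rationalPlace`). By additive Hilbert 90 a point
`x` of `E` carries `p` solutions or none, according as the absolute trace of `f(x)` vanishes or not.
Hence `N(f)` is the number of `x` in `E` with `Tr f(x) = 0` (`normCount_eq_card`).

Conjugate points have the same trace, so the count runs over closed points `P`, weighted by their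
degrees. If `p` divides `[E : F(x)]`, the trace of `f(x)` is zero for every `f`. These degenerate
points contribute a constant. At the other closed points `Tr f(P)` is uniform in `ZMod p`, and
interpolation makes any `⌊d / r⌋` of these values independent (`isEquidistributedOn_traceEval`). The
centred count is thus a weighted sum of indicators with limited independence. Its moments up to
order `2K` agree with those of a fully independent model once `d ≥ 2Kr`. Taylor's formula turns this
into closeness of characteristic functions, and the independent model obeys a central limit theorem
with explicit error (`norm_expect_exp_sum_sub_exp_le_of_equidistributed`). Here `K` depends only on
the frequency and the tolerance, so `n` and `d` may grow independently.

Almost all elements of `E` have degree `r`, so the sum of the squared degrees is asymptotic to `r q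
^ r`, which gives the variance. The mean is `q ^ r / p + D (1 - 1 / p)`, where `D` is the number of
degenerate points: `0` if `p ∤ r` and `q ^ (r / p)` otherwise. For `p > 2` this is `o(q ^ (r / 2))`;
for `p = 2` it is exactly the shift `q ^ (r / 2) / 2` of the second case. -/

noncomputable section

namespace ArtinSchreier

/-! ### Rational places centred at affine points -/

section Places

variable {p : ℕ} {K L : Type*} [Field K] [Field L] [Algebra K L]

/-- The elements `x`, `y` of `L` form a generic point of the curve `y ^ p - y = f(x)` over `K`,
and `L` is generated by them. -/
structure IsGenericPoint (p : ℕ) (f : K[X]) (x y : L) : Prop where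
  transcendental : Transcendental K x
  equation : y ^ p - y = aeval x f
  evalEval_eq_zero : ∀ P : K[X][X], eval₂ (aeval x : K[X] →ₐ[K] L).toRingHom y P = 0 →
    ∀ a b : K, b ^ p - b = f.eval a → evalEval a b P = 0
  exists_repr : ∀ z : L, ∃ (c : Fin p → K[X]) (g : K[X]), g ≠ 0 ∧
    z * aeval x g = ∑ j, aeval x (c j) * y ^ (j : ℕ)

theorem residue_eq_residue_iff (V : ValuationSubring L) (u v : V) :
    IsLocalRing.residue V u = IsLocalRing.residue V v ↔ (u - v : L) ∈ V.nonunits := by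
  rw [← sub_eq_zero, ← map_sub, IsLocalRing.residue_eq_zero_iff,
    ← ValuationSubring.coe_mem_nonunits_iff]
  rfl

theorem RationalPlace.ext' {V W : RationalPlace K L} (h : V.ring = W.ring) : V = W := by
  cases V; cases W; cases h; rfl

theorem RationalPlace.exists_sub_mem_nonunits (V : RationalPlace K L) {u : L} (hu : u ∈ V.ring) :
    ∃ c : K, u - algebraMap K L c ∈ V.ring.nonunits := by
  obtain ⟨c, hc⟩ := V.residue ⟨u, hu⟩
  exact ⟨c, (residue_eq_residue_iff V.ring _ _).1 hc⟩

/-- The place attached to a proper valuation ring containing the constants, all of whose elements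
are constant modulo the maximal ideal. -/
def RationalPlace.mk' (V : ValuationSubring L) (hK : ∀ c : K, algebraMap K L c ∈ V) (ht : V ≠ ⊤)
    (h : ∀ u ∈ V, ∃ c : K, u - algebraMap K L c ∈ V.nonunits) : RationalPlace K L where
  ring := V
  algebraMap_mem := hK
  ne_top := ht
  residue u := by
    obtain ⟨c, hc⟩ := h u u.2
    exact ⟨c, (residue_eq_residue_iff V _ _).2 hc⟩

theorem RationalPlace.constant_of_mem_nonunits (V : RationalPlace K L) {c : K}
    (hc : algebraMap K L c ∈ V.ring.nonunits) : c = 0 := by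
  by_contra h0
  rw [ValuationSubring.mem_nonunits_iff_or] at hc
  rcases hc with hc | hc
  · exact h0 ((map_eq_zero _).1 hc)
  · rw [← map_inv₀] at hc
    exact hc (V.algebraMap_mem _)

theorem nonunits_add {V : ValuationSubring L} {u v : L} (hu : u ∈ V.nonunits)
    (hv : v ∈ V.nonunits) : u + v ∈ V.nonunits :=
  V.nonunits.add_mem hu hv

theorem nonunits_sub {V : ValuationSubring L} {u v : L} (hu : u ∈ V.nonunits)
    (hv : v ∈ V.nonunits) : u - v ∈ V.nonunits :=
  V.nonunits.sub_mem hu hv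

theorem nonunits_mul {V : ValuationSubring L} {u v : L} (hu : u ∈ V.nonunits)
    (hv : v ∈ V) : u * v ∈ V.nonunits := by
  rw [ValuationSubring.mem_nonunits_iff] at *
  rw [← ValuationSubring.valuation_le_one_iff] at hv
  rw [map_mul]
  exact mul_lt_one_of_lt_of_le hu hv

/-- Evaluation of polynomials in two variables at `(x, y)`. -/
abbrev evalAt (x y : L) : K[X][X] →+* L := eval₂RingHom (aeval x : K[X] →ₐ[K] L).toRingHom y

/-- Divide by `Y - b`, then divide the remainder, a polynomial in `X` alone, by `X - a`. -/
theorem exists_eq_add_mul_add_mul (a b : K) (P : K[X][X]) : ∃ Q R : K[X][X],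
    P = C (C (evalEval a b P)) + C (X - C a) * Q + (X - C (C b)) * R := by
  obtain ⟨R, hR⟩ := X_sub_C_dvd_sub_C_eval (a := C b) (p := P)
  obtain ⟨Q, hQ⟩ := X_sub_C_dvd_sub_C_eval (a := a) (p := P.eval (C b))
  refine ⟨C Q, R, ?_⟩
  rw [← C_mul, ← hQ, ← hR]
  simp [evalEval]

variable {f : K[X]} {x y : L}

/-- The ideal of the point `(a, b)` in the coordinate ring. -/
abbrev pointIdeal (x y : L) (a b : K) : Ideal (evalAt (K := K) x y).range :=
  (RingHom.ker (evalEvalRingHom a b)).map (evalAt (K := K) x y).rangeRestrict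

theorem mem_pointIdeal {a b : K} {u : (evalAt (K := K) x y).range} :
    u ∈ pointIdeal x y a b ↔ ∃ P : K[X][X], evalEval a b P = 0 ∧ evalAt x y P = u := by
  rw [Ideal.mem_map_iff_of_surjective (evalAt (K := K) x y).rangeRestrict (RingHom.rangeRestrict_surjective _)]
  constructor
  · rintro ⟨P, hP, rfl⟩
    exact ⟨P, by simpa using hP, rfl⟩
  · rintro ⟨P, hP, hu⟩
    exact ⟨P, by simpa using hP, Subtype.ext hu⟩

/-- Every relation between `x` and `y` vanishes at `(a, b)`, so the kernel of evaluation at `(a, b)`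
contains the kernel of `evalAt` and its image stays prime. -/
theorem IsGenericPoint.isPrime_pointIdeal (h : IsGenericPoint p f x y) {a b : K}
    (hab : b ^ p - b = f.eval a) : (pointIdeal (K := K) x y a b).IsPrime := by
  have : (RingHom.ker (evalEvalRingHom a b)).IsPrime := RingHom.ker_isPrime _
  refine Ideal.map_isPrime_of_surjective (RingHom.rangeRestrict_surjective _) ?_
  intro P hP
  rw [RingHom.mem_ker] at hP ⊢
  exact h.evalEval_eq_zero P (congrArg Subtype.val hP) a b hab

theorem IsGenericPoint.mem_pointIdeal_iff (h : IsGenericPoint p f x y) {a b : K}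
    (hab : b ^ p - b = f.eval a) (P : K[X][X]) :
    (evalAt x y).rangeRestrict P ∈ pointIdeal x y a b ↔ evalEval a b P = 0 := by
  rw [mem_pointIdeal]
  constructor
  · rintro ⟨Q, hQ, hPQ⟩
    have := h.evalEval_eq_zero (P - Q) (by
      have : evalAt x y (P - Q) = 0 := by rw [map_sub, hPQ]; simp
      exact this) a b hab
    rw [evalEval_sub, hQ, sub_zero] at this
    exact this
  · intro hP
    exact ⟨P, hP, rfl⟩

theorem IsGenericPoint.exists_div (h : IsGenericPoint p f x y) (z : L) :
    ∃ P Q : K[X][X], evalAt x y Q ≠ 0 ∧ z * evalAt x y Q = evalAt x y P := by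
  obtain ⟨c, g, hg, hz⟩ := h.exists_repr z
  refine ⟨∑ j, C (c j) * X ^ (j : ℕ), C g, ?_, ?_⟩
  · have := transcendental_iff.1 h.transcendental g
    simp only [coe_eval₂RingHom, eval₂_C]
    exact fun h0 => hg (this h0)
  · simp only [coe_eval₂RingHom, eval₂_C, eval₂_finsetSum, eval₂_mul, eval₂_pow, eval₂_X]
    exact hz

/-- Smoothness: `(y - b) ((y - b) ^ (p - 1) - 1) = f(x) - f(a)` is a multiple of `x - a`, and the
second factor on the left is a unit near `(a, b)`. So `x - a` generates the maximal ideal. -/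
theorem IsGenericPoint.maximalIdeal_isPrincipal [Fact p.Prime] [CharP K p]
    (h : IsGenericPoint p f x y) {a b : K} (hab : b ^ p - b = f.eval a)
    [(pointIdeal (K := K) x y a b).IsPrime] :
    (IsLocalRing.maximalIdeal
      (LocalSubring.ofPrime _ (pointIdeal (K := K) x y a b)).toSubring).IsPrincipal := by
  have hp : p.Prime := Fact.out
  have : CharP L p := charP_of_injective_algebraMap (algebraMap K L).injective p
  set A := (evalAt (K := K) x y).range
  set M := pointIdeal (K := K) x y a b
  set R := (LocalSubring.ofPrime A M).toSubring
  set ψ := (algebraMap A R).comp (evalAt (K := K) x y).rangeRestrict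
  obtain ⟨g, hg⟩ := X_sub_C_dvd_sub_C_eval (a := a) (p := f)
  have hw : IsUnit (ψ ((X - C (C b)) ^ (p - 1) - 1)) := by
    rw [RingHom.comp_apply, IsLocalization.AtPrime.isUnit_to_map_iff R M]
    simp only [Ideal.primeCompl, Submonoid.mem_mk, Subsemigroup.mem_mk, Set.mem_compl_iff,
      SetLike.mem_coe]
    rw [h.mem_pointIdeal_iff hab]
    have hp1 : p - 1 ≠ 0 := Nat.sub_ne_zero_of_lt hp.one_lt
    simp [evalEval, hp1]
  have hrel : ψ (X - C (C b)) * ψ ((X - C (C b)) ^ (p - 1) - 1) = ψ (C (X - C a)) * ψ (C g) := by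
    rw [← map_mul, ← map_mul, RingHom.comp_apply, RingHom.comp_apply]
    congr 1
    apply Subtype.ext
    change evalAt x y _ = evalAt x y _
    have e1 : (X - C (C b) : K[X][X]) * ((X - C (C b)) ^ (p - 1) - 1) =
        (X - C (C b)) ^ p - (X - C (C b)) := by
      obtain ⟨m, rfl⟩ : ∃ m, p = m + 1 := ⟨p - 1, by have := hp.one_lt; omega⟩
      rw [Nat.add_sub_cancel]; ring
    rw [e1, ← C_mul, ← hg]
    have e2 : (aeval x : K[X] →ₐ[K] L) (C b) = algebraMap K L b := aeval_C x b
    simp only [coe_eval₂RingHom, eval₂_sub, eval₂_pow, eval₂_X, eval₂_C]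
    simp only [AlgHom.toRingHom_eq_coe, RingHom.coe_coe, aeval_C, map_sub]
    rw [sub_pow_char, ← hab, map_sub, map_pow, ← h.equation]
    ring
  refine ⟨ψ (C (X - C a)), ?_⟩
  rw [← IsLocalization.AtPrime.map_eq_maximalIdeal M R]
  apply le_antisymm
  · rw [Ideal.map_le_iff_le_comap]
    rintro ⟨u, hu⟩ huM
    obtain ⟨P, hP, hPu⟩ := mem_pointIdeal.1 huM
    obtain ⟨Q, S, hQS⟩ := exists_eq_add_mul_add_mul a b P
    have hu' : algebraMap A R ⟨u, hu⟩ = ψ P := congrArg (algebraMap A R) (Subtype.ext hPu.symm)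
    rw [Ideal.mem_comap, hu', hQS, hP]
    change _ ∈ Ideal.span _
    rw [Ideal.mem_span_singleton]
    obtain ⟨w, hw⟩ := hw
    have h3 : ψ (X - C (C b)) = ψ (C (X - C a)) * (ψ (C g) * (↑w⁻¹ : R)) := by
      rw [← mul_assoc, ← hrel, ← hw, mul_assoc, Units.mul_inv, mul_one]
    simp only [map_add, map_mul, map_zero, zero_add]
    rw [h3]
    exact dvd_add (dvd_mul_right _ _) (Dvd.intro _ (by rw [mul_assoc, mul_assoc]))
  · change Ideal.span _ ≤ _
    rw [Ideal.span_singleton_le_iff_mem]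
    refine Ideal.mem_map_of_mem _ ?_
    rw [h.mem_pointIdeal_iff hab]
    simp [evalEval]

theorem IsGenericPoint.exists_valuationSubring_eq_ofPrime [Fact p.Prime] [CharP K p]
    (h : IsGenericPoint p f x y) {a b : K} (hab : b ^ p - b = f.eval a)
    [(pointIdeal (K := K) x y a b).IsPrime] :
    ∃ V : ValuationSubring L,
      V.toLocalSubring = LocalSubring.ofPrime _ (pointIdeal (K := K) x y a b) := by
  set A := (evalAt (K := K) x y).range
  set M := pointIdeal (K := K) x y a b
  set R := (LocalSubring.ofPrime A M).toSubring with hR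
  have : IsNoetherianRing A := isNoetherianRing_range _
  have : IsNoetherianRing R := IsLocalization.isNoetherianRing M.primeCompl R inferInstance
  -- A Noetherian local domain with principal maximal ideal is a valuation ring.
  have hV : ValuationRing R :=
    ((tfae_of_isNoetherianRing_of_isLocalRing_of_isDomain R).out 1 4).2
      (h.maximalIdeal_isPrincipal hab)
  refine ⟨⟨R, fun z => ?_⟩, rfl⟩
  obtain ⟨P, Q, hQ, hPQ⟩ := h.exists_div z
  have hA : ∀ P, evalAt (K := K) x y P ∈ R := fun P =>
    LocalSubring.le_ofPrime A M (RingHom.mem_range_self _ P)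
  obtain ⟨⟨c, hc⟩, hc'⟩ := ValuationRing.cond (⟨_, hA P⟩ : R) ⟨_, hA Q⟩
  rw [Subtype.ext_iff, Subtype.ext_iff] at hc'
  simp only [Subring.coe_mul] at hc'
  by_cases hz : z = 0
  · left; rw [hz]; exact R.zero_mem
  rcases hc' with hc' | hc'
  · right
    have : z⁻¹ = c := by
      rw [← hPQ] at hc'
      have : evalAt x y Q * (z * c) = evalAt x y Q * 1 := by rw [mul_one]; linear_combination hc'
      exact inv_eq_of_mul_eq_one_right (mul_left_cancel₀ hQ this)
    rw [this]; exact hc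
  · left
    have : z = c := by
      rw [← hPQ] at hc'
      apply mul_left_cancel₀ hQ
      linear_combination -hc'
    rw [this]; exact hc

theorem evalAt_C_C (x y : L) (c : K) : evalAt x y (C (C c)) = algebraMap K L c := by
  simp

/-- The point `(a, b)` is the center of the place `V`. -/
def IsCenter (x y : L) (a b : K) (V : ValuationSubring L) : Prop :=
  x - algebraMap K L a ∈ V.nonunits ∧ y - algebraMap K L b ∈ V.nonunits

theorem RationalPlace.evalAt_mem (V : RationalPlace K L) {a b : K}
    (hV : IsCenter x y a b V.ring) (P : K[X][X]) :
    evalAt x y P ∈ V.ring ∧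
      evalAt x y P - algebraMap K L (evalEval a b P) ∈ V.ring.nonunits := by
  have hx : x ∈ V.ring := by
    simpa using V.ring.add_mem _ _ (V.ring.nonunits_subset hV.1) (V.algebraMap_mem a)
  have hy : y ∈ V.ring := by
    simpa using V.ring.add_mem _ _ (V.ring.nonunits_subset hV.2) (V.algebraMap_mem b)
  have key : ∀ P : K[X][X], evalAt x y P ∈ V.ring := by
    intro P
    simp only [coe_eval₂RingHom, eval₂_eq_sum_range]
    refine sum_mem fun i _ => V.ring.mul_mem _ _ ?_ (pow_mem hy i)
    change aeval x (P.coeff i) ∈ _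
    rw [aeval_eq_sum_range]
    refine sum_mem fun i _ => ?_
    rw [Algebra.smul_def]
    exact V.ring.mul_mem _ _ (V.algebraMap_mem _) (pow_mem hx i)
  refine ⟨key P, ?_⟩
  obtain ⟨Q, R, h⟩ := exists_eq_add_mul_add_mul a b P
  have h1 := congrArg (evalAt x y) h
  rw [map_add, map_add, evalAt_C_C, map_mul, map_mul] at h1
  have h2 : evalAt x y (C (X - C a)) = x - algebraMap K L a := by simp
  have h3 : evalAt x y (X - C (C b)) = y - algebraMap K L b := by simp
  rw [h2, h3] at h1
  have h4 : evalAt x y P - algebraMap K L (evalEval a b P) =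
      (x - algebraMap K L a) * evalAt x y Q + (y - algebraMap K L b) * evalAt x y R := by
    linear_combination h1
  rw [h4]
  exact nonunits_add (nonunits_mul hV.1 (key Q)) (nonunits_mul hV.2 (key R))

theorem mem_ofPrime_iff {A : Subring L} {M : Ideal A} [M.IsPrime] {u : L} :
    u ∈ (LocalSubring.ofPrime A M).toSubring ↔ ∃ α β : A, β ∉ M ∧ u * β = α := by
  have hinj : ∀ s : A, s ∉ M → (s : L) ≠ 0 := fun s hs h0 => by
    have : s = 0 := Subtype.ext h0
    exact hs (this ▸ M.zero_mem)
  constructor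
  · intro hu
    obtain ⟨⟨α, β⟩, h⟩ := IsLocalization.surj M.primeCompl
      (⟨u, hu⟩ : (LocalSubring.ofPrime A M).toSubring)
    exact ⟨α, β, β.2, congrArg Subtype.val h⟩
  · rintro ⟨α, β, hβ, h⟩
    have hu : IsUnit (algebraMap A (LocalSubring.ofPrime A M).toSubring β) :=
      (IsLocalization.AtPrime.isUnit_to_map_iff _ M β).2 hβ
    obtain ⟨w, hw⟩ := hu
    have h1 : ((w : (LocalSubring.ofPrime A M).toSubring) : L) = β := congrArg Subtype.val hw
    have h2 : (β : L) * ((w⁻¹ : (LocalSubring.ofPrime A M).toSubringˣ) :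
        (LocalSubring.ofPrime A M).toSubring) = 1 := by
      rw [← h1, ← Subring.coe_mul, Units.mul_inv, Subring.coe_one]
    have h3 : u = α * ((w⁻¹ : (LocalSubring.ofPrime A M).toSubringˣ) :
        (LocalSubring.ofPrime A M).toSubring) := by
      rw [← h, mul_assoc, h2, mul_one]
    rw [h3]
    exact Subring.mul_mem _ (LocalSubring.le_ofPrime A M α.2) (SetLike.coe_mem _)

theorem IsGenericPoint.existsUnique_affine [Fact p.Prime] [CharP K p]
    (h : IsGenericPoint p f x y) {a b : K} (hab : b ^ p - b = f.eval a) :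
    ∃! V : RationalPlace K L, IsCenter x y a b V.ring := by
  have hM := h.isPrime_pointIdeal hab
  obtain ⟨V, hV⟩ := h.exists_valuationSubring_eq_ofPrime hab
  -- The ring consists of the fractions whose denominator does not vanish at `(a, b)`.
  have hmem : ∀ u, u ∈ V ↔ ∃ P Q : K[X][X], evalEval a b Q ≠ 0 ∧
      u * evalAt x y Q = evalAt x y P := by
    intro u
    rw [← ValuationSubring.mem_toSubring]
    change u ∈ V.toLocalSubring.toSubring ↔ _
    rw [hV, mem_ofPrime_iff]
    constructor
    · rintro ⟨⟨_, P, rfl⟩, ⟨_, Q, rfl⟩, h1, h2⟩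
      refine ⟨P, Q, fun h3 => h1 ?_, h2⟩
      exact (h.mem_pointIdeal_iff hab Q).2 h3
    · rintro ⟨P, Q, h1, h2⟩
      exact ⟨(evalAt x y).rangeRestrict P, (evalAt x y).rangeRestrict Q, fun h3 => h1 ((h.mem_pointIdeal_iff hab Q).1 h3), h2⟩
  have hA : ∀ P, evalAt (K := K) x y P ∈ V := fun P =>
    (hmem _).2 ⟨P, 1, by simp [evalEval], by simp⟩
  have hne : ∀ P, evalEval a b P ≠ 0 → evalAt x y P ≠ 0 := fun P hP h0 =>
    hP (h.evalEval_eq_zero P h0 a b hab)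
  have hnon : ∀ P, evalEval a b P = 0 → evalAt x y P ∈ V.nonunits := by
    intro P hP
    rw [ValuationSubring.mem_nonunits_iff_or]
    by_contra! hcon
    obtain ⟨S, Q, hQ, hSQ⟩ := (hmem _).1 hcon.2
    have h1 : evalAt x y (Q - P * S) = 0 := by
      rw [map_sub, map_mul, ← hSQ, mul_inv_cancel_left₀ hcon.1, sub_self]
    have h2 := h.evalEval_eq_zero _ h1 a b hab
    rw [evalEval_sub, evalEval_mul, hP, zero_mul, sub_zero] at h2
    exact hQ h2
  have hK : ∀ c : K, algebraMap K L c ∈ V := fun c => by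
    rw [← evalAt_C_C x y]; exact hA _
  have hcenter : IsCenter x y a b V := by
    constructor
    · have h2 : evalAt x y (C (X - C a)) = x - algebraMap K L a := by simp
      rw [← h2]
      exact hnon _ (by simp [evalEval])
    · have h3 : evalAt x y (X - C (C b)) = y - algebraMap K L b := by simp
      rw [← h3]
      exact hnon _ (by simp [evalEval])
  have htop : V ≠ ⊤ := by
    rintro rfl
    have h1 := hcenter.1
    rw [ValuationSubring.mem_nonunits_iff_or] at h1
    rcases h1 with h1 | h1
    · refine h.transcendental ?_
      rw [sub_eq_zero.1 h1]
      exact isAlgebraic_algebraMap a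
    · exact h1 (ValuationSubring.mem_top _)
  have hres : ∀ u ∈ V, ∃ c : K, u - algebraMap K L c ∈ V.nonunits := by
    intro u hu
    obtain ⟨P, Q, hQ, hPQ⟩ := (hmem u).1 hu
    refine ⟨evalEval a b P / evalEval a b Q, ?_⟩
    have hQ' := hne Q hQ
    have hQi : (evalAt x y Q)⁻¹ ∈ V :=
      (hmem _).2 ⟨1, Q, hQ, by rw [inv_mul_cancel₀ hQ', map_one]⟩
    have hu' : u = evalAt x y P * (evalAt x y Q)⁻¹ := by
      rw [← hPQ, mul_inv_cancel_right₀ hQ']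
    have hcast : algebraMap K L (evalEval a b P / evalEval a b Q) =
        evalAt x y (C (C (evalEval a b P / evalEval a b Q))) := (evalAt_C_C x y _).symm
    have h1 : u - algebraMap K L (evalEval a b P / evalEval a b Q) =
        evalAt x y (P - C (C (evalEval a b P / evalEval a b Q)) * Q) * (evalAt x y Q)⁻¹ := by
      rw [map_sub, map_mul, sub_mul, mul_inv_cancel_right₀ hQ', hcast, hu']
    rw [h1]
    refine nonunits_mul (hnon _ ?_) hQi
    rw [evalEval_sub, evalEval_mul]
    simp only [evalEval, eval_C]
    rw [div_mul_cancel₀ _ hQ, sub_self]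
  refine ⟨RationalPlace.mk' V hK htop hres, hcenter, fun W hW => RationalPlace.ext' ?_⟩
  have hinv : ∀ Q, evalEval a b Q ≠ 0 → (evalAt x y Q)⁻¹ ∈ W.ring := by
    intro Q hQ
    by_contra hcon
    have h1 : evalAt x y Q ∈ W.ring.nonunits := by
      rw [ValuationSubring.mem_nonunits_iff_or]; exact Or.inr hcon
    have h2 := nonunits_sub h1 (W.evalAt_mem hW Q).2
    rw [sub_sub_cancel] at h2
    exact hQ (W.constant_of_mem_nonunits h2)
  -- Inclusion of valuation rings reverses inclusion of nonunits. A nonunit of `V` is a fraction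
  -- whose numerator vanishes at `(a, b)`, hence a nonunit of `W`; this gives `W ≤ V`.
  apply le_antisymm
  · rw [← ValuationSubring.nonunits_le_nonunits]
    intro u hu
    obtain ⟨P, Q, hQ, hPQ⟩ := (hmem u).1 (V.nonunits_subset hu)
    have hu' : u = evalAt x y P * (evalAt x y Q)⁻¹ := by
      rw [← hPQ, mul_inv_cancel_right₀ (hne Q hQ)]
    have hP : evalEval a b P = 0 := by
      by_contra hP
      rw [ValuationSubring.mem_nonunits_iff_or] at hu
      rcases hu with rfl | hu
      · rw [zero_mul] at hPQ
        exact hne P hP hPQ.symm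
      · refine hu ((hmem _).2 ⟨Q, P, hP, ?_⟩)
        rw [hu', mul_inv, inv_inv, mul_comm, mul_inv_cancel_left₀ (hne P hP)]
    rw [hu']
    refine nonunits_mul ?_ (hinv Q hQ)
    have := (W.evalAt_mem hW P).2
    rwa [hP, map_zero, sub_zero] at this
  · intro u hu
    obtain ⟨P, Q, hQ, hPQ⟩ := (hmem u).1 hu
    have hu' : u = evalAt x y P * (evalAt x y Q)⁻¹ := by
      rw [← hPQ, mul_inv_cancel_right₀ (hne Q hQ)]
    rw [hu']
    exact W.ring.mul_mem _ _ (W.evalAt_mem hW P).1 (hinv Q hQ)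

end Places

/-! ### The unique place at infinity and the count of all rational places -/

section Infinity

variable {p : ℕ} {K L : Type*} [Field K] [Field L] [Algebra K L] {f : K[X]} {x y : L}

theorem isTrivialOn_valuation (V : ValuationSubring L) (hK : ∀ c : K, algebraMap K L c ∈ V) :
    V.valuation.IsTrivialOn K := by
  refine ⟨fun c hc => ?_⟩
  have h1 := (V.valuation_le_one_iff _).2 (hK c)
  have h2 := (V.valuation_le_one_iff _).2 (hK c⁻¹)
  have h3 : V.valuation (algebraMap K L c) * V.valuation (algebraMap K L c⁻¹) = 1 := by
    rw [← map_mul, ← map_mul, mul_inv_cancel₀ hc, map_one, map_one]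
  refine le_antisymm h1 ?_
  calc 1 = V.valuation (algebraMap K L c) * V.valuation (algebraMap K L c⁻¹) := h3.symm
    _ ≤ V.valuation (algebraMap K L c) * 1 := mul_le_mul_right h2 _
    _ = _ := mul_one _

variable (p) in
/-- The order of the pole of `c(x) y ^ j` at infinity, for `c ≠ 0`. -/
def poleOrder (f c : K[X]) (j : ℕ) : ℕ := p * c.natDegree + f.natDegree * j

/-- Modulo `p` the order is `d j`, and `d` is invertible modulo `p`. So terms with different powers
of `y` never have poles of the same order, and no cancellation occurs at infinity. -/
theorem poleOrder_injective (hf : f.natDegree.Coprime p) {c c' : K[X]} {j j' : Fin p}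
    (h : poleOrder p f c j = poleOrder p f c' j') : j = j' := by
  unfold poleOrder at h
  have h1 : f.natDegree * (j : ℕ) ≡ f.natDegree * j' [MOD p] := by
    have := congrArg (· % p) h
    simpa [Nat.ModEq] using this
  have h2 := Nat.ModEq.cancel_left_of_coprime (Nat.gcd_comm _ _ ▸ hf) h1
  exact Fin.ext (Nat.ModEq.eq_of_lt_of_lt h2 j.2 j'.2)

theorem exists_dominant (hf : f.natDegree.Coprime p) {c : Fin p → K[X]} (hc : c ≠ 0) :
    ∃ i, c i ≠ 0 ∧ ∀ j, j ≠ i → c j ≠ 0 → poleOrder p f (c j) j < poleOrder p f (c i) i := by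
  classical
  obtain ⟨k, hk⟩ := Function.ne_iff.1 hc
  obtain ⟨i, hi, hmax⟩ := Finset.exists_max_image (Finset.univ.filter fun j => c j ≠ 0)
    (fun j => poleOrder p f (c j) j) ⟨k, by simpa using hk⟩
  refine ⟨i, by simpa using hi, fun j hj hj0 => lt_of_le_of_ne (hmax j (by simpa using hj0)) ?_⟩
  exact fun h => hj (poleOrder_injective hf h)

/-- Where `x` has a pole so does `y`, and the leading terms of both sides of the equation dominate.
-/
theorem valuation_y_pow [Fact p.Prime] (hxy : y ^ p - y = aeval x f)
    (hf : f.natDegree.Coprime p) (V : ValuationSubring L)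
    (hK : ∀ c : K, algebraMap K L c ∈ V) (hx : x ∉ V) :
    V.valuation y ^ p = V.valuation x ^ f.natDegree := by
  have hp : p.Prime := Fact.out
  have := isTrivialOn_valuation V hK
  have hx1 : 1 < V.valuation x := not_le.1 fun h => hx ((V.valuation_le_one_iff _).1 h)
  have hd : f.natDegree ≠ 0 := fun h => by
    rw [h, Nat.coprime_zero_left] at hf; exact hp.one_lt.ne' hf
  have hf0 : f ≠ 0 := by rintro rfl; exact hd natDegree_zero
  have h1 := valuation_aeval_eq_valuation_X_pow_natDegree_of_one_lt_valuation_X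
    (v := V.valuation) x hx1 hf0
  rw [← h1, ← hxy]
  have hgt : 1 < V.valuation (y ^ p - y) := by rw [hxy, h1]; exact one_lt_pow₀ hx1 hd
  have hy : 1 < V.valuation y := by
    by_contra! hy
    refine hgt.not_ge ((V.valuation.map_sub _ _).trans (max_le ?_ hy))
    rw [map_pow]; exact pow_le_one₀ zero_le hy
  rw [Valuation.map_sub_eq_of_lt_left, map_pow]
  rw [map_pow]
  exact lt_self_pow₀ hy hp.one_lt

theorem valuation_term [Fact p.Prime] (hxy : y ^ p - y = aeval x f)
    (hf : f.natDegree.Coprime p) (V : ValuationSubring L)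
    (hK : ∀ c : K, algebraMap K L c ∈ V) (hx : x ∉ V) {c : K[X]} (hc : c ≠ 0) (j : ℕ) :
    V.valuation (aeval x c * y ^ j) ^ p = V.valuation x ^ poleOrder p f c j := by
  have := isTrivialOn_valuation V hK
  have hx1 : 1 < V.valuation x := not_le.1 fun h => hx ((V.valuation_le_one_iff _).1 h)
  rw [map_mul, map_pow, mul_pow, pow_right_comm, valuation_y_pow hxy hf V hK hx,
    valuation_aeval_eq_valuation_X_pow_natDegree_of_one_lt_valuation_X
      (v := V.valuation) x hx1 hc, poleOrder, pow_add, pow_mul, pow_mul, pow_right_comm]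

/-- The ultrametric inequality is an equality when one term dominates. Taking `p`-th powers
expresses all values through that of `x`, with no knowledge of the value group. -/
theorem valuation_sum [Fact p.Prime] (hxy : y ^ p - y = aeval x f)
    (hf : f.natDegree.Coprime p) (V : ValuationSubring L)
    (hK : ∀ c : K, algebraMap K L c ∈ V) (hx : x ∉ V) {c : Fin p → K[X]} {i : Fin p}
    (hi : c i ≠ 0)
    (hlt : ∀ j, j ≠ i → c j ≠ 0 → poleOrder p f (c j) j < poleOrder p f (c i) i) :
    V.valuation (∑ j, aeval x (c j) * y ^ (j : ℕ)) ^ p =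
      V.valuation x ^ poleOrder p f (c i) i := by
  have hp : p.Prime := Fact.out
  have hx1 : 1 < V.valuation x := not_le.1 fun h => hx ((V.valuation_le_one_iff _).1 h)
  rw [V.valuation.map_sum_eq_of_lt (Finset.mem_univ i), valuation_term hxy hf V hK hx hi]
  intro j hj
  have hj' : j ≠ i := by simpa using hj
  rw [← pow_lt_pow_iff_left₀ zero_le zero_le hp.ne_zero,
    valuation_term hxy hf V hK hx hi]
  by_cases h0 : c j = 0
  · rw [h0, map_zero, zero_mul, map_zero, zero_pow hp.ne_zero]
    exact pow_pos (zero_lt_one.trans hx1) _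
  · rw [valuation_term hxy hf V hK hx h0]
    exact pow_lt_pow_right₀ hx1 (hlt j hj' h0)

theorem valuation_aeval_sum_eq [Fact p.Prime] (hxy : y ^ p - y = aeval x f)
    (hf : f.natDegree.Coprime p) (V : ValuationSubring L)
    (hK : ∀ c : K, algebraMap K L c ∈ V) (hx : x ∉ V) {c : Fin p → K[X]} {i : Fin p}
    (hi : c i ≠ 0)
    (hlt : ∀ j, j ≠ i → c j ≠ 0 → poleOrder p f (c j) j < poleOrder p f (c i) i)
    {g : K[X]} (hg : g ≠ 0) {z : L} (hz : z * aeval x g = ∑ j, aeval x (c j) * y ^ (j : ℕ)) :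
    (V.valuation z) ^ p * V.valuation x ^ (p * g.natDegree) =
      V.valuation x ^ poleOrder p f (c i) i := by
  have := isTrivialOn_valuation V hK
  have hx1 : 1 < V.valuation x := not_le.1 fun h => hx ((V.valuation_le_one_iff _).1 h)
  rw [← valuation_sum hxy hf V hK hx hi hlt, ← hz, map_mul, mul_pow,
    valuation_aeval_eq_valuation_X_pow_natDegree_of_one_lt_valuation_X
      (v := V.valuation) x hx1 hg, ← pow_mul, mul_comm p]

/-- Whether a nonzero `z` is integral is decided by comparing the dominant pole order of its
numerator with `p * g.natDegree`, a condition that does not involve the valuation ring. -/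
theorem IsGenericPoint.le_of_not_mem [Fact p.Prime] (h : IsGenericPoint p f x y)
    (hf : f.natDegree.Coprime p) (V W : ValuationSubring L)
    (hKV : ∀ c : K, algebraMap K L c ∈ V) (hKW : ∀ c : K, algebraMap K L c ∈ W)
    (hxV : x ∉ V) (hxW : x ∉ W) : V ≤ W := by
  have hp : p.Prime := Fact.out
  have hV1 : 1 < V.valuation x := not_le.1 fun h => hxV ((V.valuation_le_one_iff _).1 h)
  have hW1 : 1 < W.valuation x := not_le.1 fun h => hxW ((W.valuation_le_one_iff _).1 h)
  intro z hz
  by_cases hz0 : z = 0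
  · rw [hz0]; exact W.zero_mem
  obtain ⟨c, g, hg, hzc⟩ := h.exists_repr z
  have hgx : aeval x g ≠ 0 := fun h0 => hg (transcendental_iff.1 h.transcendental g h0)
  have hc : c ≠ 0 := by
    rintro rfl
    simp only [Pi.zero_apply, map_zero, zero_mul, Finset.sum_const_zero, mul_eq_zero] at hzc
    exact hzc.elim hz0 hgx
  obtain ⟨i, hi, hlt⟩ := exists_dominant hf hc
  have hV := valuation_aeval_sum_eq h.equation hf V hKV hxV hi hlt hg hzc
  have hW := valuation_aeval_sum_eq h.equation hf W hKW hxW hi hlt hg hzc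
  rw [← V.valuation_le_one_iff] at hz
  rw [← W.valuation_le_one_iff]
  have h1 : poleOrder p f (c i) i ≤ p * g.natDegree := by
    rw [← pow_le_pow_iff_right₀ hV1, ← hV]
    calc _ ≤ 1 * _ := mul_le_mul_left (pow_le_one₀ zero_le hz) _
      _ = _ := one_mul _
  have h2 := pow_le_pow_right₀ hW1.le h1
  rw [← hW] at h2
  have h3 : W.valuation z ^ p ≤ 1 := by
    by_contra! hcon
    refine h2.not_gt ?_
    have hpos : 0 < W.valuation x ^ (p * g.natDegree) := pow_pos (zero_lt_one.trans hW1) _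
    calc _ = 1 * W.valuation x ^ (p * g.natDegree) := (one_mul _).symm
      _ < _ := mul_lt_mul_of_pos_right hcon hpos
  exact (pow_le_one_iff_of_nonneg zero_le hp.ne_zero).1 h3

/-- For a unit, equality of pole orders forces the dominant term to be the one with `j = 0` and with
the degree of the denominator. The residue is the quotient of the leading coefficients; subtracting
it lowers the order. -/
theorem IsGenericPoint.exists_constant_of_not_mem [Fact p.Prime] (h : IsGenericPoint p f x y)
    (hf : f.natDegree.Coprime p) (V : ValuationSubring L)
    (hK : ∀ c : K, algebraMap K L c ∈ V) (hx : x ∉ V) {z : L} (hz : z ∈ V) :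
    ∃ a : K, z - algebraMap K L a ∈ V.nonunits := by
  have hp : p.Prime := Fact.out
  have hx1 : 1 < V.valuation x := not_le.1 fun h => hx ((V.valuation_le_one_iff _).1 h)
  by_cases hz1 : V.valuation z < 1
  · exact ⟨0, by rwa [map_zero, sub_zero, ValuationSubring.mem_nonunits_iff]⟩
  replace hz1 : V.valuation z = 1 :=
    le_antisymm ((V.valuation_le_one_iff _).2 hz) (not_lt.1 hz1)
  have hz0 : z ≠ 0 := by rintro rfl; simp at hz1
  obtain ⟨c, g, hg, hzc⟩ := h.exists_repr z
  have hgx : aeval x g ≠ 0 := fun h0 => hg (transcendental_iff.1 h.transcendental g h0)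
  have hc : c ≠ 0 := by
    rintro rfl
    simp only [Pi.zero_apply, map_zero, zero_mul, Finset.sum_const_zero, mul_eq_zero] at hzc
    exact hzc.elim hz0 hgx
  obtain ⟨i, hi, hlt⟩ := exists_dominant hf hc
  have hV := valuation_aeval_sum_eq h.equation hf V hK hx hi hlt hg hzc
  rw [hz1, one_pow, one_mul] at hV
  have hord : p * g.natDegree = poleOrder p f (c i) i := (pow_right_strictMono₀ hx1).injective hV
  have hi0 : i = ⟨0, hp.pos⟩ := by
    refine poleOrder_injective hf (c := c i) (c' := g) ?_
    rw [← hord, poleOrder, mul_zero, add_zero]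
  have hdeg : (c i).natDegree = g.natDegree := by
    rw [hi0, poleOrder] at hord
    simp only [mul_zero, add_zero] at hord
    rw [hi0]
    exact (Nat.eq_of_mul_eq_mul_left hp.pos hord).symm
  set a := (c i).leadingCoeff / g.leadingCoeff with ha
  have hlg : g.leadingCoeff ≠ 0 := leadingCoeff_ne_zero.2 hg
  have ha0 : a ≠ 0 := div_ne_zero (leadingCoeff_ne_zero.2 hi) hlg
  refine ⟨a, ?_⟩
  classical
  have hsum : (z - algebraMap K L a) * aeval x g =
      ∑ j, aeval x (Function.update c i (c i - C a * g) j) * y ^ (j : ℕ) := by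
    rw [sub_mul, hzc, ← Finset.add_sum_erase _ _ (Finset.mem_univ i),
      ← Finset.add_sum_erase _ _ (Finset.mem_univ i), Function.update_self]
    have hcongr : ∑ j ∈ Finset.univ.erase i,
        aeval x (Function.update c i (c i - C a * g) j) * y ^ (j : ℕ) =
        ∑ j ∈ Finset.univ.erase i, aeval x (c j) * y ^ (j : ℕ) :=
      Finset.sum_congr rfl fun j hj => by rw [Function.update_of_ne (Finset.ne_of_mem_erase hj)]
    rw [hcongr]
    have : (i : ℕ) = 0 := by rw [hi0]
    rw [this, map_sub, map_mul, aeval_C]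
    ring
  rw [ValuationSubring.mem_nonunits_iff]
  have hpos : 0 < V.valuation (aeval x g) := by
    rw [zero_lt_iff, Valuation.ne_zero_iff]; exact hgx
  have : V.valuation.IsTrivialOn K := isTrivialOn_valuation V hK
  have hvg : V.valuation (aeval x g) ^ p = V.valuation x ^ poleOrder p f (c i) i := by
    rw [valuation_aeval_eq_valuation_X_pow_natDegree_of_one_lt_valuation_X
      (v := V.valuation) x hx1 hg, ← hord, ← pow_mul, mul_comm]
  have key : V.valuation ((z - algebraMap K L a) * aeval x g) < V.valuation (aeval x g) := by
    rw [hsum]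
    refine V.valuation.map_sum_lt hpos.ne' fun j _ => ?_
    by_cases hj0 : Function.update c i (c i - C a * g) j = 0
    · rw [hj0, map_zero, zero_mul, map_zero]; exact hpos
    rw [← pow_lt_pow_iff_left₀ zero_le zero_le hp.ne_zero, hvg,
      valuation_term h.equation hf V hK hx hj0]
    refine pow_lt_pow_right₀ hx1 ?_
    by_cases hj : j = i
    · subst hj
      rw [Function.update_self] at hj0 ⊢
      have hdlt : (c j - C a * g).natDegree < (c j).natDegree := by
        refine natDegree_lt_natDegree hj0 (degree_sub_lt_left ?_ hi ?_)
        · rw [degree_C_mul ha0, degree_eq_natDegree hi, degree_eq_natDegree hg, hdeg]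
        · rw [leadingCoeff_mul, leadingCoeff_C, ha, div_mul_cancel₀ _ hlg]
      unfold poleOrder
      have := Nat.mul_lt_mul_of_pos_left hdlt hp.pos
      omega
    · rw [Function.update_of_ne hj] at hj0 ⊢
      exact hlt j hj hj0
  rw [map_mul] at key
  by_contra! hcon
  refine key.not_ge ?_
  calc V.valuation (aeval x g) = 1 * _ := (one_mul _).symm
    _ ≤ _ := mul_le_mul_left hcon _

/-- As `x⁻¹` is transcendental, it generates a proper ideal of `K[x⁻¹]`, and some valuation ring
containing `K[x⁻¹]` has it among its nonunits. -/
theorem exists_valuationSubring_not_mem (hx : Transcendental K x) :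
    ∃ V : ValuationSubring L, (∀ c : K, algebraMap K L c ∈ V) ∧ x ∉ V := by
  have hx' : Transcendental K x⁻¹ := by
    rw [Transcendental, IsAlgebraic.inv_iff]; exact hx
  have hx0 : x ≠ 0 := by rintro rfl; exact hx isAlgebraic_zero
  set A := (aeval x⁻¹ : K[X] →ₐ[K] L).toRingHom.range
  have hA : x⁻¹ ∈ A := ⟨X, aeval_X _⟩
  obtain ⟨V, hV, hI⟩ := Ideal.image_subset_nonunits_valuationSubring
    (Ideal.span {(⟨x⁻¹, hA⟩ : A)}) (by
      rw [Ne, Ideal.eq_top_iff_one, Ideal.mem_span_singleton]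
      rintro ⟨⟨_, P, rfl⟩, h⟩
      have h1 : (1 : L) = x⁻¹ * aeval x⁻¹ P := congrArg Subtype.val h
      have h2 : aeval x⁻¹ (X * P - 1) = 0 := by
        rw [map_sub, map_mul, aeval_X, ← h1, map_one, sub_self]
      have h3 := transcendental_iff.1 hx' _ h2
      have h4 := congrArg (eval 0) h3
      simp at h4)
  refine ⟨V, fun c => hV ⟨C c, aeval_C _ _⟩, ?_⟩
  have h1 : x⁻¹ ∈ V.nonunits := hI ⟨⟨x⁻¹, hA⟩, Ideal.mem_span_singleton_self _, rfl⟩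
  rw [ValuationSubring.inv_mem_nonunits_iff] at h1
  exact h1.resolve_left hx0

theorem IsGenericPoint.existsUnique_infinity [Fact p.Prime] (h : IsGenericPoint p f x y)
    (hf : f.natDegree.Coprime p) : ∃! V : RationalPlace K L, x ∉ V.ring := by
  obtain ⟨V, hK, hx⟩ := exists_valuationSubring_not_mem h.transcendental
  refine ⟨RationalPlace.mk' V hK (fun h => hx (h ▸ ValuationSubring.mem_top x))
    fun u hu => h.exists_constant_of_not_mem hf V hK hx hu, hx, fun W hW => ?_⟩
  exact RationalPlace.ext' (le_antisymm (h.le_of_not_mem hf _ _ W.algebraMap_mem hK hW hx)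
    (h.le_of_not_mem hf _ _ hK W.algebraMap_mem hx hW))

theorem IsGenericPoint.existsUnique_center [Fact p.Prime] (h : IsGenericPoint p f x y)
    (V : RationalPlace K L) (hx : x ∈ V.ring) :
    ∃! s : {s : K × K // s.2 ^ p - s.2 = f.eval s.1}, IsCenter x y s.1.1 s.1.2 V.ring := by
  have hp : p.Prime := Fact.out
  have hfx : aeval x f ∈ V.ring := by
    rw [aeval_eq_sum_range]
    refine sum_mem fun i _ => ?_
    rw [Algebra.smul_def]
    exact V.ring.mul_mem _ _ (V.algebraMap_mem _) (pow_mem hx i)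
  -- A pole of `y` would give `y ^ p - y` a pole, although `f(x)` has none.
  have hy : y ∈ V.ring := by
    rw [← ValuationSubring.valuation_le_one_iff] at hfx ⊢
    by_contra! hy
    rw [← h.equation, Valuation.map_sub_eq_of_lt_left, map_pow] at hfx
    · exact (one_lt_pow₀ hy hp.ne_zero).not_ge hfx
    · rw [map_pow]; exact lt_self_pow₀ hy hp.one_lt
  obtain ⟨a, ha⟩ := V.exists_sub_mem_nonunits hx
  obtain ⟨b, hb⟩ := V.exists_sub_mem_nonunits hy
  have hab : b ^ p - b = f.eval a := by
    have h1 := (V.evalAt_mem (x := x) (y := y) ⟨ha, hb⟩ (X ^ p - X - C f)).2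
    have h2 : evalAt x y (X ^ p - X - C f) = 0 := by
      simp only [coe_eval₂RingHom, eval₂_sub, eval₂_pow, eval₂_X, eval₂_C]
      exact sub_eq_zero.2 h.equation
    rw [h2, zero_sub, ← map_neg] at h1
    have h3 := V.constant_of_mem_nonunits h1
    simp only [evalEval, eval_sub, eval_pow, eval_X, eval_C, neg_eq_zero] at h3
    exact sub_eq_zero.1 h3
  refine ⟨⟨(a, b), hab⟩, ⟨ha, hb⟩, ?_⟩
  rintro ⟨⟨a', b'⟩, h'⟩ ⟨ha', hb'⟩
  have e1 := nonunits_sub ha ha'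
  have e2 := nonunits_sub hb hb'
  rw [sub_sub_sub_cancel_left, ← map_sub] at e1 e2
  have e1 := sub_eq_zero.1 (V.constant_of_mem_nonunits e1)
  have e2 := sub_eq_zero.1 (V.constant_of_mem_nonunits e2)
  simp only at e1 e2
  subst e1; subst e2; rfl

/-- The places of degree one are the point at infinity and the affine points. -/
theorem IsGenericPoint.card_rationalPlace [Fact p.Prime] [CharP K p] [Finite K]
    (h : IsGenericPoint p f x y) (hf : f.natDegree.Coprime p) :
    Nat.card (RationalPlace K L) =
      Nat.card {s : K × K // s.2 ^ p - s.2 = f.eval s.1} + 1 := by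
  classical
  choose P hP hP' using fun s : {s : K × K // s.2 ^ p - s.2 = f.eval s.1} =>
    h.existsUnique_affine s.2
  obtain ⟨Q, hQ, hQ'⟩ := h.existsUnique_infinity hf
  have hPx : ∀ s, x ∈ (P s).ring := fun s => by
    simpa using (P s).ring.add_mem _ _ ((P s).ring.nonunits_subset (hP s).1)
      ((P s).algebraMap_mem s.1.1)
  rw [← Finite.card_option]
  refine (Nat.card_congr (Equiv.ofBijective (fun s => Option.elim s Q P) ⟨?_, ?_⟩)).symm
  · rintro (_ | s) (_ | t) hst
    · rfl
    · simp only [Option.elim] at hst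
      exact absurd (hPx t) (hst ▸ hQ)
    · simp only [Option.elim] at hst
      exact absurd (hPx s) (hst ▸ hQ)
    · simp only [Option.elim] at hst
      congr 1
      exact (h.existsUnique_center (P s) (hPx s)).unique (hP s) (hst ▸ hP t)
  · intro V
    by_cases hx : x ∈ V.ring
    · obtain ⟨s, hs, -⟩ := h.existsUnique_center V hx
      exact ⟨some s, (hP' s V hs).symm⟩
    · exact ⟨none, (hQ' V hx).symm⟩

end Infinity

/-! ### The function field of the curve -/

section NumPoints

variable {p : ℕ} {K : Type*} [Field K] {f : K[X]}

theorem isGenericPoint_adjoinRoot [Fact p.Prime] (h : Irreducible (equation p f)) :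
    haveI : Fact (Irreducible (equation p f)) := ⟨h⟩
    IsGenericPoint (K := K) (L := AdjoinRoot (equation p f)) p f
      (algebraMap (RatFunc K) _ RatFunc.X) (AdjoinRoot.root (equation p f)) := by
  have hp : p.Prime := Fact.out
  have : Fact (Irreducible (equation p f)) := ⟨h⟩
  set L := AdjoinRoot (equation p f)
  set x : L := algebraMap (RatFunc K) _ RatFunc.X
  set y : L := AdjoinRoot.root (equation p f)
  have haev : ∀ g : K[X], aeval x g = algebraMap (RatFunc K) L (algebraMap K[X] (RatFunc K) g) := by
    intro g
    rw [aeval_algebraMap_apply]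
    congr 1
    rw [← RatFunc.algebraMap_X, aeval_algebraMap_apply, aeval_X_left_apply]
  have hmon : ((X ^ p - X - C f : K[X][X])).Monic := by
    have h1 : (X ^ p - X - C f : K[X][X]) = X ^ p - (X + C f) := by ring
    rw [h1]
    refine monic_X_pow_sub ?_
    rw [degree_X_add_C]
    exact_mod_cast hp.one_lt
  have hmap : equation p f = (X ^ p - X - C f : K[X][X]).map (algebraMap K[X] (RatFunc K)) := by
    simp [equation]
  have hinj : Function.Injective (algebraMap K[X] (RatFunc K)) := RatFunc.algebraMap_injective K
  have hof : ∀ g, AdjoinRoot.of (equation p f) g = algebraMap (RatFunc K) L g := fun _ => rfl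
  refine ⟨?_, ?_, ?_, ?_⟩
  · rw [transcendental_iff]
    intro g hg
    rw [haev] at hg
    exact (map_eq_zero_iff _ hinj).1 ((map_eq_zero _).1 hg)
  · rw [haev, ← sub_eq_zero]
    have : eval₂ (AdjoinRoot.of (equation p f)) (AdjoinRoot.root (equation p f))
      (X ^ p - X - C (algebraMap K[X] (RatFunc K) f)) = 0 := AdjoinRoot.eval₂_root (equation p f)
    rw [eval₂_sub, eval₂_sub, eval₂_pow, eval₂_X, eval₂_C] at this
    exact this
  · intro P hP a b hab
    have h1 : AdjoinRoot.mk (equation p f) (P.map (algebraMap K[X] (RatFunc K))) = 0 := by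
      rw [← hP, ← AdjoinRoot.aeval_eq, aeval_def, eval₂_map]
      congr 1
      ext g
      · simp [haev, hof]
      · simp [haev, hof]
    rw [AdjoinRoot.mk_eq_zero, hmap, map_dvd_map _ hinj hmon] at h1
    obtain ⟨Q, rfl⟩ := h1
    rw [evalEval_mul]
    simp [evalEval, hab]
  · intro z
    obtain ⟨q, rfl⟩ := AdjoinRoot.mk_surjective z
    have hmon' : (equation p f).Monic := hmap ▸ hmon.map _
    have hdeg : (equation p f).natDegree = p := by
      rw [equation, natDegree_sub_C, FiniteField.X_pow_card_sub_X_natDegree_eq _ hp.one_lt]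
    set r := q %ₘ equation p f
    have hr : AdjoinRoot.mk (equation p f) q = AdjoinRoot.mk (equation p f) r := by
      rw [AdjoinRoot.mk_eq_mk]
      have := modByMonic_add_div q (equation p f)
      exact ⟨q /ₘ equation p f, by linear_combination -this⟩
    have hrdeg : r.natDegree < p := by
      rw [← hdeg]
      exact natDegree_modByMonic_lt _ hmon' (fun h1 => h.not_isUnit (h1 ▸ isUnit_one))
    obtain ⟨g, hg⟩ := IsLocalization.exist_integer_multiples (nonZeroDivisors K[X])
      (Finset.univ : Finset (Fin p)) (fun j => r.coeff j)
    choose c hc using fun j => hg j (Finset.mem_univ j)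
    refine ⟨c, g, nonZeroDivisors.coe_ne_zero g, ?_⟩
    rw [hr, haev]
    conv_lhs => rw [as_sum_range' r p hrdeg, ← Fin.sum_univ_eq_sum_range
      (fun i => monomial i (r.coeff i)), map_sum, Finset.sum_mul]
    refine Finset.sum_congr rfl fun j _ => ?_
    rw [haev, hc, ← C_mul_X_pow_eq_monomial, map_mul, map_pow, AdjoinRoot.mk_X, AdjoinRoot.mk_C,
      Algebra.smul_def, map_mul, hof]
    change _ * y ^ (j : ℕ) * _ = _
    ring

/-- The number of rational points of the curve `y ^ p - y = f(x)`. -/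
theorem numPoints_eq [Fact p.Prime] [CharP K p] [Finite K] (hf : f.natDegree.Coprime p) :
    numPoints p f = Nat.card {s : K × K // s.2 ^ p - s.2 = f.eval s.1} + 1 := by
  have h := irreducible_equation p f hf
  rw [numPoints, dif_pos h]
  have : Fact (Irreducible (equation p f)) := ⟨h⟩
  exact (isGenericPoint_adjoinRoot h).card_rationalPlace hf

end NumPoints

/-! ### Additive Hilbert 90 and the fibres over the affine line -/

section HilbertNinety

variable (p : ℕ) [Fact p.Prime] (E : Type*) [Field E] [Algebra (ZMod p) E]

/-- The linear map `b ↦ b ^ p - b`. -/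
def artinSchreierMap : E →ₗ[ZMod p] E where
  toFun b := b ^ p - b
  map_add' a b := by
    have : CharP E p := charP_of_injective_algebraMap (algebraMap (ZMod p) E).injective p
    rw [add_pow_char]; ring
  map_smul' c b := by
    rw [Algebra.smul_def, mul_pow, ← map_pow, ZMod.pow_card, RingHom.id_apply, Algebra.smul_def]
    ring

variable {p E}

theorem artinSchreierMap_apply (b : E) : artinSchreierMap p E b = b ^ p - b := rfl

theorem mem_ker_artinSchreierMap {b : E} :
    b ∈ LinearMap.ker (artinSchreierMap p E) ↔ b ∈ LinearMap.range (Algebra.linearMap (ZMod p) E) := by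
  have : CharP E p := charP_of_injective_algebraMap (algebraMap (ZMod p) E).injective p
  rw [LinearMap.mem_ker, artinSchreierMap_apply, sub_eq_zero,
    ← Subfield.mem_bot_iff_pow_eq_self E p, mem_bot_iff_intCast p E]
  constructor
  · rintro ⟨n, rfl⟩
    exact ⟨n, by simp⟩
  · rintro ⟨c, rfl⟩
    refine ⟨c.cast, ?_⟩
    rw [← map_intCast (algebraMap (ZMod p) E), ZMod.intCast_zmod_cast]
    rfl

theorem finrank_ker_artinSchreierMap :
    Module.finrank (ZMod p) (LinearMap.ker (artinSchreierMap p E)) = 1 := by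
  have h : LinearMap.ker (artinSchreierMap p E) = LinearMap.range (Algebra.linearMap (ZMod p) E) :=
    Submodule.ext fun b => mem_ker_artinSchreierMap
  rw [h, LinearMap.finrank_range_of_inj (algebraMap (ZMod p) E).injective, Module.finrank_self]

theorem card_ker_artinSchreierMap :
    Nat.card (LinearMap.ker (artinSchreierMap p E)) = p := by
  have := Module.finite_of_finrank_eq_succ (finrank_ker_artinSchreierMap (p := p) (E := E))
  rw [Module.natCard_eq_pow_finrank (K := ZMod p), finrank_ker_artinSchreierMap, pow_one,
    Nat.card_zmod]

/-- The additive form of Hilbert's theorem 90. -/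
theorem range_artinSchreierMap [Finite E] :
    LinearMap.range (artinSchreierMap p E) = LinearMap.ker (Algebra.trace (ZMod p) E) := by
  have : Module.Finite (ZMod p) E := Module.Finite.of_finite
  apply Submodule.eq_of_le_of_finrank_eq
  · rintro _ ⟨b, rfl⟩
    rw [LinearMap.mem_ker, artinSchreierMap_apply, map_sub, sub_eq_zero]
    have h := Algebra.trace_eq_of_algEquiv (FiniteField.frobeniusAlgEquivOfAlgebraic (ZMod p) E) b
    rw [← h]
    simp
  -- Both spaces have codimension one: the kernel of `b ↦ b ^ p - b` is the prime field, and the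
  -- trace is onto it.
  · have h1 := LinearMap.finrank_range_add_finrank_ker (artinSchreierMap p E)
    have h2 := LinearMap.finrank_range_add_finrank_ker (Algebra.trace (ZMod p) E)
    rw [LinearMap.range_eq_top.2 (Algebra.trace_surjective (ZMod p) E), finrank_top,
      Module.finrank_self] at h2
    rw [finrank_ker_artinSchreierMap] at h1
    omega

-- A nonempty fibre is a coset of the kernel, which has `p` elements.
open Classical in
theorem card_solutions [Finite E] (c : E) :
    Nat.card {b : E // b ^ p - b = c} = if Algebra.trace (ZMod p) E c = 0 then p else 0 := by
  split_ifs with h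
  · have hc : c ∈ LinearMap.range (artinSchreierMap p E) := by
      rw [range_artinSchreierMap]; exact h
    obtain ⟨b₀, hb₀⟩ := hc
    refine Eq.trans ?_ (card_ker_artinSchreierMap (p := p) (E := E))
    refine Nat.card_congr (Equiv.subtypeEquiv (Equiv.subRight b₀) fun b => ?_)
    rw [Equiv.subRight_apply, LinearMap.mem_ker, map_sub, hb₀, sub_eq_zero]
    rfl
  · rw [Nat.card_eq_zero]
    left
    refine ⟨fun b => h ?_⟩
    have : c ∈ LinearMap.range (artinSchreierMap p E) := ⟨b, b.2⟩
    rwa [range_artinSchreierMap] at this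

theorem card_affine_points [Finite E] (f : E[X]) :
    Nat.card {s : E × E // s.2 ^ p - s.2 = f.eval s.1} =
      p * Nat.card {a : E // Algebra.trace (ZMod p) E (f.eval a) = 0} := by
  classical
  have := Fintype.ofFinite E
  have e : {s : E × E // s.2 ^ p - s.2 = f.eval s.1} ≃ Σ a : E, {b : E // b ^ p - b = f.eval a} :=
    { toFun := fun s => ⟨s.1.1, s.1.2, s.2⟩
      invFun := fun s => ⟨(s.1, s.2.1), s.2.2⟩
      left_inv := fun _ => rfl
      right_inv := fun _ => rfl }
  rw [Nat.card_congr e, Nat.card_sigma]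
  simp only [card_solutions]
  rw [← Finset.sum_filter, Finset.sum_const, smul_eq_mul, mul_comm, Nat.card_eq_fintype_card,
    Fintype.card_subtype]

end HilbertNinety

/-! ### Traces of values of polynomials, and interpolation -/

section Trace

variable {p : ℕ} [Fact p.Prime] {F E : Type*} [Field F] [Field E] [Algebra F E]
  [Algebra (ZMod p) E]

variable (p F) in
/-- The absolute trace of the value at `x` of a polynomial over `F`. -/
def traceEval (x : E) : F[X] →+ ZMod p :=
  (Algebra.trace (ZMod p) E).toAddMonoidHom.comp (aeval x : F[X] →ₐ[F] E).toRingHom.toAddMonoidHom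

theorem traceEval_apply (x : E) (g : F[X]) :
    traceEval p F x g = Algebra.trace (ZMod p) E (aeval x g) := rfl

theorem normCount_eq_card [Finite E] (f : F[X]) (hf : f.natDegree.Coprime p) :
    normCount p E f = Nat.card {x : E // traceEval p F x f = 0} := by
  have hp : (p : ℝ) ≠ 0 := Nat.cast_ne_zero.2 (Fact.out : p.Prime).ne_zero
  have : CharP E p := charP_of_injective_algebraMap (algebraMap (ZMod p) E).injective p
  rw [normCount, numPoints_eq (by rwa [natDegree_map]), card_affine_points]
  simp only [eval_map_algebraMap, traceEval_apply]
  push_cast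
  rw [add_sub_cancel_right, mul_div_cancel_left₀ _ hp]

open IntermediateField

/-- Elements with the same minimal polynomial are conjugate, and the trace is invariant under
automorphisms. -/
theorem traceEval_eq_of_minpoly_eq [Finite F] [Finite E] [Algebra (ZMod p) F]
    [IsScalarTower (ZMod p) F E]
    {x y : E} (h : minpoly F x = minpoly F y) (g : F[X]) :
    traceEval p F x g = traceEval p F y g := by
  rw [Normal.minpoly_eq_iff_mem_orbit] at h
  obtain ⟨σ, rfl⟩ := h
  rw [traceEval_apply, traceEval_apply]
  have h1 : aeval (σ • y) g = (σ.restrictScalars (ZMod p)) (aeval y g) := by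
    rw [AlgEquiv.smul_def, AlgEquiv.restrictScalars_apply, aeval_algHom_apply]
  rw [h1, Algebra.trace_eq_of_algEquiv]

/-- By transitivity of the trace. The factor `[E : F(x)]`, read modulo `p`, separates degenerate
points from the others. -/
theorem trace_coe_adjoin [Finite E] [Algebra (ZMod p) F] [IsScalarTower (ZMod p) F E] (x : E)
    (z : F⟮x⟯) : Algebra.trace (ZMod p) E (z : E) =
      Module.finrank F⟮x⟯ E * Algebra.trace (ZMod p) F⟮x⟯ z := by
  have : Module.Finite (ZMod p) E := Module.Finite.of_finite
  have : Module.Finite (ZMod p) F⟮x⟯ := Module.Finite.of_finite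
  have : Module.Finite F⟮x⟯ E := Module.Finite.of_finite
  rw [← Algebra.trace_trace (S := F⟮x⟯)]
  change Algebra.trace (ZMod p) F⟮x⟯ (Algebra.trace F⟮x⟯ E (algebraMap F⟮x⟯ E z)) = _
  rw [Algebra.trace_algebraMap, map_nsmul, nsmul_eq_mul]

theorem traceEval_eq_zero_of_dvd [Finite E] [Algebra (ZMod p) F] [IsScalarTower (ZMod p) F E]
    {x : E} (hx : p ∣ Module.finrank F⟮x⟯ E) (g : F[X]) : traceEval p F x g = 0 := by
  have h : aeval x g = ((aeval (AdjoinSimple.gen F x) g : F⟮x⟯) : E) := by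
    rw [← IntermediateField.aeval_coe]
    simp
  rw [traceEval_apply, h, trace_coe_adjoin, (ZMod.natCast_eq_zero_iff _ _).2 hx, zero_mul]

theorem exists_trace_eq_one [Finite E] [Algebra (ZMod p) F] [IsScalarTower (ZMod p) F E]
    {x : E} (hx : ¬ p ∣ Module.finrank F⟮x⟯ E) :
    ∃ z : F⟮x⟯, Algebra.trace (ZMod p) E (z : E) = 1 := by
  have : Module.Finite (ZMod p) F⟮x⟯ := Module.Finite.of_finite
  obtain ⟨z, hz⟩ := Algebra.trace_surjective (ZMod p) F⟮x⟯ (Module.finrank F⟮x⟯ E : ZMod p)⁻¹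
  refine ⟨z, ?_⟩
  rw [trace_coe_adjoin, hz, mul_inv_cancel₀]
  rwa [Ne, ZMod.natCast_eq_zero_iff]

/-- Interpolation at distinct closed points by polynomials of small degree. -/
theorem exists_aeval_eq_single [Finite E] {ι : Type*} (s : Finset ι) (ξ : ι → E)
    (hξ : Set.InjOn (fun i => minpoly F (ξ i)) s) {d : ℕ}
    (hd : ∑ i ∈ s, (minpoly F (ξ i)).natDegree ≤ d) {i : ι} (hi : i ∈ s) (z : F⟮ξ i⟯) :
    ∃ g ∈ degreeLT F d, aeval (ξ i) g = z ∧ ∀ j ∈ s, j ≠ i → aeval (ξ j) g = 0 := by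
  classical
  have hint : ∀ x : E, IsIntegral F x := fun x => IsIntegral.of_finite F x
  -- `U` vanishes at the other points. The quotient of `z` by the value of `U` at `ξ i` lies in `F(ξ
  -- i)`, so it is the value of a polynomial of degree below that of `minpoly F (ξ i)`; the product
  -- with `U` has degree less than `d`.
  set U := ∏ j ∈ s.erase i, minpoly F (ξ j)
  have hUmon : U.Monic := monic_prod_of_monic _ _ fun j _ => minpoly.monic (hint _)
  have hU : aeval (ξ i) U ≠ 0 := by
    rw [map_prod, Finset.prod_ne_zero_iff]
    intro j hj h0
    refine Finset.ne_of_mem_erase hj (hξ (Finset.mem_of_mem_erase hj) hi ?_)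
    exact minpoly.eq_of_irreducible_of_monic (minpoly.irreducible (hint _)) h0
      (minpoly.monic (hint _))
  have hUd : U.natDegree + (minpoly F (ξ i)).natDegree = ∑ i ∈ s, (minpoly F (ξ i)).natDegree := by
    rw [natDegree_prod_of_monic _ _ fun j _ => minpoly.monic (hint _),
      Finset.sum_erase_add _ _ hi]
  have hz : (z : E) / aeval (ξ i) U ∈ F⟮ξ i⟯ :=
    div_mem z.2 (IntermediateField.algebra_adjoin_le_adjoin F _
      (aeval_mem_adjoin_singleton F (ξ i)))
  rw [← IntermediateField.mem_toSubalgebra,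
    IntermediateField.adjoin_simple_toSubalgebra_of_isAlgebraic (hint _).isAlgebraic,
    Algebra.adjoin_singleton_eq_range_aeval] at hz
  obtain ⟨h₀, hh₀⟩ := hz
  have hh : aeval (ξ i) (h₀ %ₘ minpoly F (ξ i)) = (z : E) / aeval (ξ i) U := by
    rw [← hh₀]
    have h1 := congrArg (aeval (ξ i)) (modByMonic_add_div h₀ (minpoly F (ξ i)))
    rw [map_add, map_mul, minpoly.aeval, zero_mul, add_zero] at h1
    exact h1
  refine ⟨U * (h₀ %ₘ minpoly F (ξ i)), ?_, ?_, ?_⟩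
  · rw [mem_degreeLT]
    by_cases h0 : h₀ %ₘ minpoly F (ξ i) = 0
    · rw [h0, mul_zero, degree_zero]; exact WithBot.bot_lt_coe d
    rw [degree_eq_natDegree (mul_ne_zero hUmon.ne_zero h0), Nat.cast_lt,
      natDegree_mul hUmon.ne_zero h0]
    have := natDegree_modByMonic_lt h₀ (minpoly.monic (hint (ξ i)))
      (fun h1 => minpoly.ne_one F (ξ i) h1)
    omega
  · rw [map_mul, hh, mul_div_cancel₀ _ hU]
  · intro j hj hji
    rw [map_mul, map_prod, Finset.prod_eq_zero (Finset.mem_erase.2 ⟨hji, hj⟩) (minpoly.aeval F _),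
      zero_mul]

end Trace

open scoped BigOperators

/-! ### Taylor remainders of the exponential on the imaginary axis -/

section Taylor

open Complex in
/-- The Taylor approximation of the exponential along a ray in the imaginary axis. -/
theorem norm_exp_sub_taylor_le_of_nonneg {c : ℂ} (hc : c.re = 0) (hc1 : ‖c‖ = 1) (n : ℕ) {x : ℝ}
    (hx : 0 ≤ x) :
    ‖exp (c * x) - ∑ k ∈ Finset.range n, (c * x) ^ k / (k.factorial : ℂ)‖ ≤
      x ^ n / n.factorial := by
  induction n generalizing x with
  | zero =>
    simp only [Finset.range_zero, Finset.sum_empty, sub_zero, pow_zero, Nat.factorial_zero,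
      Nat.cast_one, div_one]
    rw [norm_exp]
    simp [hc]
  | succ n ih =>
    -- The derivative of each remainder is `c` times the previous one, so the bound follows by
    -- induction from the mean value inequality.
    have hd : ∀ y : ℝ, HasDerivAt
        (fun y : ℝ => exp (c * y) - ∑ k ∈ Finset.range (n + 1), (c * y) ^ k / (k.factorial : ℂ))
        (c * (exp (c * y) - ∑ k ∈ Finset.range n, (c * y) ^ k / (k.factorial : ℂ))) y := by
      intro y
      have hl : HasDerivAt (fun y : ℝ => c * (y : ℂ)) c y := by
        simpa using (ofRealCLM.hasDerivAt (x := y)).const_mul c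
      have hs : HasDerivAt
          (fun y : ℝ => ∑ k ∈ Finset.range (n + 1), (c * y) ^ k / (k.factorial : ℂ))
          (∑ k ∈ Finset.range (n + 1), (k * (c * y) ^ (k - 1) * c) / (k.factorial : ℂ)) y :=
        HasDerivAt.fun_sum fun k _ => ((hl.pow k).div_const _)
      convert! hl.cexp.sub hs using 1
      rw [Finset.sum_range_succ', mul_sub, Finset.mul_sum]
      simp only [Nat.cast_zero, zero_mul, zero_div, add_zero]
      congr 1
      · ring
      · refine Finset.sum_congr rfl fun k _ => ?_
        rw [Nat.factorial_succ, Nat.add_sub_cancel]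
        push_cast
        have h1 : (k.factorial : ℂ) ≠ 0 := Nat.cast_ne_zero.2 k.factorial_ne_zero
        have h2 : (k : ℂ) + 1 ≠ 0 := Nat.cast_add_one_ne_zero k
        field_simp
    have hB : ∀ y : ℝ, HasDerivAt (fun y : ℝ => y ^ (n + 1) / ((n + 1).factorial : ℝ))
        (y ^ n / n.factorial) y := by
      intro y
      convert! (hasDerivAt_pow (n + 1) y).div_const ((n + 1).factorial : ℝ) using 1
      rw [Nat.factorial_succ, Nat.add_sub_cancel]
      push_cast
      have h1 : (n.factorial : ℝ) ≠ 0 := Nat.cast_ne_zero.2 n.factorial_ne_zero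
      have h2 : (n : ℝ) + 1 ≠ 0 := Nat.cast_add_one_ne_zero n
      field_simp
    refine image_norm_le_of_norm_deriv_right_le_deriv_boundary (a := 0) (b := x)
      (fun y _ => (hd y).continuousAt.continuousWithinAt)
      (fun y _ => (hd y).hasDerivWithinAt) ?_ hB (fun y hy => ?_) (Set.right_mem_Icc.2 hx)
    · rw [Finset.sum_range_succ']
      simp
    · rw [norm_mul, hc1, one_mul]
      exact ih hy.1

theorem norm_exp_sub_taylor_le (n : ℕ) (x : ℝ) :
    ‖Complex.exp (x * Complex.I) -
      ∑ k ∈ Finset.range n, (x * Complex.I) ^ k / (k.factorial : ℂ)‖ ≤ |x| ^ n / n.factorial := by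
  rcases le_total 0 x with h | h
  · rw [abs_of_nonneg h]
    simpa only [mul_comm] using
      norm_exp_sub_taylor_le_of_nonneg (c := Complex.I) (by simp) (by simp) n h
  · rw [abs_of_nonpos h]
    have := norm_exp_sub_taylor_le_of_nonneg (c := -Complex.I) (by simp) (by simp) n
      (neg_nonneg.2 h)
    push_cast at this
    simpa only [neg_mul_neg, mul_comm] using this

end Taylor

/-! ### Comparison of moments under limited independence -/

section Moments

variable {Ω Ω' ι α : Type*} [Fintype Ω] [Fintype Ω']

theorem ofReal_expect {Ξ : Type*} [Fintype Ξ] (f : Ξ → ℝ) : ((𝔼 ξ, f ξ : ℝ) : ℂ) = 𝔼 ξ, (f ξ : ℂ) := by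
  rw [Fintype.expect_eq_sum_div_card, Fintype.expect_eq_sum_div_card]
  push_cast; rfl

theorem norm_expect_exp_sub_moments_le (Z : Ω → ℝ) (K : ℕ) :
    ‖(𝔼 ω, Complex.exp (Z ω * Complex.I)) -
      ∑ k ∈ Finset.range (2 * K), ((𝔼 ω, Z ω ^ k : ℝ) : ℂ) * (Complex.I ^ k / k.factorial)‖ ≤
      𝔼 ω, Z ω ^ (2 * K) / (2 * K).factorial := by
  have e : ∑ k ∈ Finset.range (2 * K), ((𝔼 ω, Z ω ^ k : ℝ) : ℂ) * (Complex.I ^ k / k.factorial) =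
      𝔼 ω, ∑ k ∈ Finset.range (2 * K), (Z ω * Complex.I) ^ k / (k.factorial : ℂ) := by
    rw [Finset.expect_sum_comm]
    refine Finset.sum_congr rfl fun k _ => ?_
    rw [ofReal_expect, Finset.expect_mul]
    refine Finset.expect_congr rfl fun ω _ => ?_
    push_cast
    ring
  rw [e, ← Finset.expect_sub_distrib]
  refine (RCLike.norm_expect_le (K := ℂ)).trans (Finset.expect_le_expect fun ω _ => ?_)
  refine (norm_exp_sub_taylor_le _ _).trans_eq ?_
  -- The truncation order is even so that the remainder is bounded by a moment without absolute
  -- values.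
  rw [Even.pow_abs (even_two_mul K)]

/-- Real variables with the same first moments have close characteristic functions. -/
theorem norm_expect_exp_sub_expect_exp_le (X : Ω → ℝ) (X' : Ω' → ℝ) (K : ℕ)
    (h : ∀ k ≤ 2 * K, 𝔼 ω, X ω ^ k = 𝔼 ω, X' ω ^ k) :
    ‖(𝔼 ω, Complex.exp (X ω * Complex.I)) - 𝔼 ω, Complex.exp (X' ω * Complex.I)‖ ≤
      2 * 𝔼 ω, X' ω ^ (2 * K) / (2 * K).factorial := by
  have h1 := norm_expect_exp_sub_moments_le X K
  have h2 := norm_expect_exp_sub_moments_le X' K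
  have h3 : ∑ k ∈ Finset.range (2 * K), ((𝔼 ω, X ω ^ k : ℝ) : ℂ) * (Complex.I ^ k / k.factorial) =
      ∑ k ∈ Finset.range (2 * K), ((𝔼 ω, X' ω ^ k : ℝ) : ℂ) * (Complex.I ^ k / k.factorial) :=
    Finset.sum_congr rfl fun k hk => by rw [h k (Finset.mem_range.1 hk).le]
  have h4 : (𝔼 ω, X ω ^ (2 * K) / ((2 * K).factorial : ℝ)) =
      𝔼 ω, X' ω ^ (2 * K) / ((2 * K).factorial : ℝ) := by
    rw [← Finset.expect_div, ← Finset.expect_div, h _ le_rfl]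
  rw [h3, h4] at h1
  rw [two_mul]
  refine le_trans ?_ (add_le_add h1 h2)
  rw [norm_sub_rev (𝔼 ω, Complex.exp (X' ω * Complex.I))]
  exact norm_sub_le_norm_sub_add_norm_sub _ _ _

variable [Fintype α]

theorem expect_prod_pi {𝕜 : Type*} [Field 𝕜] [CharZero 𝕜] [Fintype ι] [DecidableEq ι]
    (u : ι → α → 𝕜) :
    𝔼 v : ι → α, ∏ i, u i (v i) = ∏ i, 𝔼 c, u i c := by
  simp_rw [Fintype.expect_eq_sum_div_card]
  rw [Finset.prod_div_distrib, Finset.prod_univ_sum, Fintype.piFinset_univ]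
  congr 1
  rw [Finset.prod_const, Fintype.card_pi, Finset.prod_const]
  push_cast; rfl

variable [AddCommGroup α]

/-- The family `Y` is uniformly distributed on the coordinates in `s`. -/
def IsEquidistributedOn [DecidableEq ι] (Y : Ω → ι → α) (s : Finset ι) : Prop :=
  ∀ h : (s → α) → ℝ, 𝔼 ω, h (fun i => Y ω i) = 𝔼 v, h v

/-- The left average is unchanged when its argument is translated by any element of `H`, so it
equals its mean over all translations. -/
theorem expect_comp_of_surjective {G H : Type*} [AddCommGroup G] [Fintype G] [AddCommGroup H]
    [Fintype H] (φ : G →+ H) (hφ : Function.Surjective φ) (c : H) (h : H → ℝ) :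
    𝔼 g, h (c + φ g) = 𝔼 v, h v := by
  have h1 : ∀ v : H, 𝔼 g, h (c + φ g + v) = 𝔼 g, h (c + φ g) := by
    intro v
    obtain ⟨g₀, rfl⟩ := hφ v
    refine Fintype.expect_equiv (Equiv.addRight g₀) _ _ fun g => ?_
    rw [Equiv.coe_addRight, map_add, add_assoc]
  rw [← Fintype.expect_const (ι := H) (𝔼 g, h (c + φ g)),
    Finset.expect_congr rfl fun v _ => (h1 v).symm, Finset.expect_comm]
  have h2 : ∀ g : G, 𝔼 v, h (c + φ g + v) = 𝔼 v, h v := fun g =>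
    Fintype.expect_equiv (Equiv.addLeft (c + φ g)) _ _ fun v => rfl
  simp_rw [h2]
  exact Fintype.expect_const _

theorem isEquidistributedOn_id [Fintype ι] [DecidableEq ι] (s : Finset ι) :
    IsEquidistributedOn (fun v : ι → α => v) s := by
  intro h
  let φ : (ι → α) →+ (s → α) :=
    { toFun := fun v i => v i, map_zero' := rfl, map_add' := fun _ _ => rfl }
  have hφ : Function.Surjective φ := fun v =>
    ⟨fun i => if hi : i ∈ s then v ⟨i, hi⟩ else 0, funext fun i => by simp [φ]⟩
  rw [← expect_comp_of_surjective φ hφ 0 h]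
  simp only [zero_add]
  rfl

/-- Each monomial in the expansion of the power involves at most `k` coordinates. -/
theorem expect_sum_pow_eq [Fintype ι] [DecidableEq ι] {Y : Ω → ι → α} {k : ℕ}
    (hY : ∀ s : Finset ι, s.card ≤ k → IsEquidistributedOn Y s) (u : ι → α → ℝ) :
    𝔼 ω, (∑ i, u i (Y ω i)) ^ k = 𝔼 v : ι → α, (∑ i, u i (v i)) ^ k := by
  simp_rw [Fintype.sum_pow]
  rw [Finset.expect_sum_comm, Finset.expect_sum_comm]
  refine Finset.sum_congr rfl fun τ _ => ?_
  have hs : (Finset.univ.image τ).card ≤ k := Finset.card_image_le.trans (by simp)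
  have hτ : ∀ j, τ j ∈ Finset.univ.image τ := fun j => Finset.mem_image_of_mem τ (Finset.mem_univ j)
  have h1 := hY _ hs (fun v => ∏ j, u (τ j) (v ⟨τ j, hτ j⟩))
  have h2 := isEquidistributedOn_id (α := α) (Finset.univ.image τ)
    (fun v => ∏ j, u (τ j) (v ⟨τ j, hτ j⟩))
  exact h1.trans h2.symm

end Moments

/-! ### Central limit theorem for weighted sums -/

section Independent

theorem norm_prod_sub_prod_le {ι : Type*} [DecidableEq ι] {z w : ι → ℂ} (hz : ∀ i, ‖z i‖ ≤ 1) (hw : ∀ i, ‖w i‖ ≤ 1)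
    (s : Finset ι) : ‖∏ i ∈ s, z i - ∏ i ∈ s, w i‖ ≤ ∑ i ∈ s, ‖z i - w i‖ := by
  induction s using Finset.induction_on with
  | empty => simp
  | insert i s hi ih =>
    rw [Finset.prod_insert hi, Finset.prod_insert hi, Finset.sum_insert hi]
    have e : z i * ∏ j ∈ s, z j - w i * ∏ j ∈ s, w j =
        (z i - w i) * ∏ j ∈ s, z j + w i * (∏ j ∈ s, z j - ∏ j ∈ s, w j) := by ring
    rw [e]
    refine (norm_add_le _ _).trans (add_le_add ?_ ?_)
    · rw [norm_mul, norm_prod]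
      exact mul_le_of_le_one_right (norm_nonneg _)
        (Finset.prod_le_one (fun _ _ => norm_nonneg _) fun j _ => hz j)
    · rw [norm_mul]
      exact (mul_le_of_le_one_left (norm_nonneg _) (hw i)).trans ih

variable {ι α : Type*} [AddCommGroup α] [Fintype α] [Fintype ι] [DecidableEq ι] {χ : α → ℝ}

/-- Use `exp x ≤ 1 + x + x ^ 2` for `|x| ≤ 1`; the linear term averages to zero. -/
theorem expect_exp_le (h0 : 𝔼 c, χ c = 0) (h1 : ∀ c, |χ c| ≤ 1) {b : ℝ} (hb : |b| ≤ 1) :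
    𝔼 c, Real.exp (b * χ c) ≤ Real.exp (b ^ 2) := by
  have h2 : ∀ c, Real.exp (b * χ c) ≤ 1 + b * χ c + b ^ 2 := by
    intro c
    have h3 : |b * χ c| ≤ 1 := by
      rw [abs_mul]; exact mul_le_one₀ hb (abs_nonneg _) (h1 c)
    have h4 := (abs_le.1 (Real.abs_exp_sub_one_sub_id_le h3)).2
    have h5 : (χ c) ^ 2 ≤ 1 := (sq_le_one_iff_abs_le_one _).2 (h1 c)
    nlinarith [sq_nonneg b]
  calc 𝔼 c, Real.exp (b * χ c) ≤ 𝔼 c, (1 + b * χ c + b ^ 2) :=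
        Finset.expect_le_expect fun c _ => h2 c
    _ = 1 + b ^ 2 := by
        rw [Finset.expect_add_distrib, Finset.expect_add_distrib, ← Finset.mul_expect, h0,
          Fintype.expect_const, Fintype.expect_const]
        ring
    _ ≤ _ := by linarith [Real.add_one_le_exp (b ^ 2)]

theorem expect_exp_sum_le (h0 : 𝔼 c, χ c = 0) (h1 : ∀ c, |χ c| ≤ 1) {b : ι → ℝ}
    (hb : ∀ i, |b i| ≤ 1) :
    𝔼 v : ι → α, Real.exp (∑ i, b i * χ (v i)) ≤ Real.exp (∑ i, b i ^ 2) := by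
  simp_rw [Real.exp_sum]
  rw [expect_prod_pi fun i c => Real.exp (b i * χ c)]
  exact Finset.prod_le_prod (fun i _ => Finset.expect_nonneg fun c _ => (Real.exp_pos _).le)
    fun i _ => expect_exp_le h0 h1 (hb i)

/-- Exponential moments control all even moments at once, by a bound that does not depend on `K`. -/
theorem expect_sum_pow_div_factorial_le (h0 : 𝔼 c, χ c = 0) (h1 : ∀ c, |χ c| ≤ 1) {b : ι → ℝ}
    (hb : ∀ i, |b i| ≤ 1) (K : ℕ) :
    𝔼 v : ι → α, (∑ i, b i * χ (v i)) ^ (2 * K) / (2 * K).factorial ≤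
      2 * Real.exp (∑ i, b i ^ 2) := by
  have h2 : ∀ x : ℝ, x ^ (2 * K) / (2 * K).factorial ≤ Real.exp x + Real.exp (-x) := by
    intro x
    rw [← Even.pow_abs (even_two_mul K)]
    refine (Real.pow_div_factorial_le_exp _ (abs_nonneg x) _).trans ?_
    rcases abs_choice x with h | h <;> rw [h] <;>
      linarith [Real.exp_pos x, Real.exp_pos (-x)]
  refine (Finset.expect_le_expect fun v _ => h2 _).trans ?_
  rw [Finset.expect_add_distrib, two_mul]
  refine add_le_add (expect_exp_sum_le h0 h1 hb) ?_
  have := expect_exp_sum_le (α := α) h0 h1 (b := fun i => -b i) (by simpa using hb)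
  simpa only [neg_mul, Finset.sum_neg_distrib, even_two, Even.neg_pow] using this

/-- Both terms are close to `1 - b ^ 2 * v / 2`, with `v` the variance: one by Taylor's formula to
third order, the other by the quadratic bound for `exp`. -/
theorem norm_expect_exp_sub_exp_le (h0 : 𝔼 c, χ c = 0) (h1 : ∀ c, |χ c| ≤ 1) {b : ℝ}
    (hb : |b| ≤ 1) :
    ‖(𝔼 c, Complex.exp ((b * χ c : ℝ) * Complex.I)) -
      Complex.exp ((-(b ^ 2 * (𝔼 c, χ c ^ 2) / 2) : ℝ))‖ ≤ |b| ^ 3 := by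
  set v := 𝔼 c, χ c ^ 2
  have hv0 : 0 ≤ v := Finset.expect_nonneg fun c _ => sq_nonneg _
  have hv1 : v ≤ 1 := Finset.expect_le Finset.univ_nonempty
    fun c _ => (sq_le_one_iff_abs_le_one _).2 (h1 c)
  have e1 : ‖(𝔼 c, Complex.exp ((b * χ c : ℝ) * Complex.I)) - ((1 - b ^ 2 * v / 2 : ℝ) : ℂ)‖ ≤
      |b| ^ 3 / 6 := by
    have e : ((1 - b ^ 2 * v / 2 : ℝ) : ℂ) = 𝔼 c, ∑ k ∈ Finset.range 3,
        ((b * χ c : ℝ) * Complex.I) ^ k / (k.factorial : ℂ) := by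
      have : ∀ c, ∑ k ∈ Finset.range 3, ((b * χ c : ℝ) * Complex.I) ^ k / (k.factorial : ℂ) =
          1 + (b * Complex.I) * (χ c : ℂ) - (b ^ 2 / 2) * ((χ c ^ 2 : ℝ) : ℂ) := by
        intro c
        simp only [Finset.sum_range_succ, Finset.sum_range_zero, Nat.factorial]
        push_cast
        have := Complex.I_sq
        linear_combination (b ^ 2 * (χ c) ^ 2 / 2 : ℂ) * this
      simp_rw [this]
      rw [Finset.expect_sub_distrib, Finset.expect_add_distrib, ← Finset.mul_expect,
        ← Finset.mul_expect, ← ofReal_expect, ← ofReal_expect, h0, Fintype.expect_const]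
      change _ = 1 + _ - _ * (v : ℂ)
      push_cast
      ring
    rw [e, ← Finset.expect_sub_distrib]
    refine (RCLike.norm_expect_le (K := ℂ)).trans
      (Finset.expect_le Finset.univ_nonempty fun c _ => ?_)
    refine (norm_exp_sub_taylor_le 3 _).trans ?_
    have : |b * χ c| ≤ |b| := by
      rw [abs_mul]; exact mul_le_of_le_one_right (abs_nonneg _) (h1 c)
    have h6 : ((3).factorial : ℝ) = 6 := by norm_num [Nat.factorial]
    rw [h6]
    gcongr
  have e2 : ‖((1 - b ^ 2 * v / 2 : ℝ) : ℂ) - Complex.exp ((-(b ^ 2 * v / 2) : ℝ))‖ ≤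
      |b| ^ 3 / 4 := by
    rw [← Complex.ofReal_exp, ← Complex.ofReal_sub, Complex.norm_real, Real.norm_eq_abs, abs_sub_comm]
    have hb2 : b ^ 2 ≤ 1 := (sq_le_one_iff_abs_le_one _).2 hb
    have h3 : |(-(b ^ 2 * v / 2))| ≤ 1 := by
      rw [abs_neg, abs_of_nonneg (by positivity)]
      nlinarith [sq_nonneg b]
    have h4 := Real.abs_exp_sub_one_sub_id_le h3
    have h5 : Real.exp (-(b ^ 2 * v / 2)) - (1 - b ^ 2 * v / 2) =
      Real.exp (-(b ^ 2 * v / 2)) - 1 - -(b ^ 2 * v / 2) := by ring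
    rw [h5]
    refine h4.trans ?_
    have h6 : |b| ^ 4 ≤ |b| ^ 3 := pow_le_pow_of_le_one (abs_nonneg b) hb (by norm_num)
    have h7 : |b| ^ 4 = (b ^ 2) ^ 2 := by rw [← sq_abs b]; ring
    have h8 : v ^ 2 ≤ 1 := pow_le_one₀ hv0 hv1
    have h9 : (b ^ 2) ^ 2 * v ^ 2 ≤ (b ^ 2) ^ 2 := mul_le_of_le_one_right (by positivity) h8
    calc (-(b ^ 2 * v / 2)) ^ 2 = ((b ^ 2) ^ 2 * v ^ 2) / 4 := by ring
      _ ≤ _ := by rw [h7] at h6; linarith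
  calc _ ≤ _ := norm_sub_le_norm_sub_add_norm_sub _ ((1 - b ^ 2 * v / 2 : ℝ) : ℂ) _
    _ ≤ |b| ^ 3 / 6 + |b| ^ 3 / 4 := add_le_add e1 e2
    _ ≤ _ := by nlinarith [pow_nonneg (abs_nonneg b) 3]

/-- Independence factors both terms into numbers of modulus at most one, which are exchanged one at
a time. -/
theorem norm_expect_exp_sum_sub_exp_le (h0 : 𝔼 c, χ c = 0) (h1 : ∀ c, |χ c| ≤ 1) {b : ι → ℝ}
    (hb : ∀ i, |b i| ≤ 1) :
    ‖(𝔼 v : ι → α, Complex.exp ((∑ i, b i * χ (v i) : ℝ) * Complex.I)) -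
      Complex.exp ((-((∑ i, b i ^ 2) * (𝔼 c, χ c ^ 2) / 2) : ℝ))‖ ≤ ∑ i, |b i| ^ 3 := by
  have e1 : (𝔼 v : ι → α, Complex.exp ((∑ i, b i * χ (v i) : ℝ) * Complex.I)) =
      ∏ i, 𝔼 c, Complex.exp ((b i * χ c : ℝ) * Complex.I) := by
    rw [← expect_prod_pi fun i c => Complex.exp ((b i * χ c : ℝ) * Complex.I)]
    refine Finset.expect_congr rfl fun v _ => ?_
    rw [← Complex.exp_sum]
    congr 1
    push_cast
    rw [Finset.sum_mul]
  have e2 : Complex.exp ((-((∑ i, b i ^ 2) * (𝔼 c, χ c ^ 2) / 2) : ℝ)) =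
      ∏ i, Complex.exp ((-(b i ^ 2 * (𝔼 c, χ c ^ 2) / 2) : ℝ)) := by
    rw [← Complex.exp_sum, ← Complex.ofReal_sum, Finset.sum_neg_distrib, Finset.sum_mul,
      Finset.sum_div]
  rw [e1, e2]
  refine (norm_prod_sub_prod_le (fun i => ?_) (fun i => ?_) _).trans
    (Finset.sum_le_sum fun i _ => norm_expect_exp_sub_exp_le h0 h1 (hb i))
  · refine (RCLike.norm_expect_le (K := ℂ)).trans
      (Finset.expect_le Finset.univ_nonempty fun c _ => ?_)
    rw [Complex.norm_exp_ofReal_mul_I]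
  · rw [← Complex.ofReal_exp, Complex.norm_real, Real.norm_eq_abs, Real.abs_exp, Real.exp_le_one_iff,
      neg_nonpos]
    have : 0 ≤ 𝔼 c, χ c ^ 2 := Finset.expect_nonneg fun c _ => sq_nonneg _
    positivity

/-- A quantitative central limit theorem for sums of variables of which any `2 * K` are
independent. -/
theorem norm_expect_exp_sum_sub_exp_le_of_equidistributed {Ω : Type*} [Fintype Ω] [Nonempty Ω]
    (h0 : 𝔼 c, χ c = 0) (h1 : ∀ c, |χ c| ≤ 1) {a : ι → ℝ} {Y : Ω → ι → α} {K : ℕ}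
    (hY : ∀ s : Finset ι, s.card ≤ 2 * K → IsEquidistributedOn Y s) {t S m : ℝ}
    (ha : ∀ i, |a i| ≤ m) (hS : 0 < S) (hSm : S * m ≤ 1) (htS : |t| ≤ S) :
    ‖(𝔼 ω, Complex.exp ((t * ∑ i, a i * χ (Y ω i) : ℝ) * Complex.I)) -
      Complex.exp ((-(t ^ 2 * ((∑ i, a i ^ 2) * (𝔼 c, χ c ^ 2)) / 2) : ℝ))‖ ≤
      4 * (|t| / S) ^ (2 * K) * Real.exp (S ^ 2 * ∑ i, a i ^ 2) +
        |t| ^ 3 * m * ∑ i, a i ^ 2 := by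
  have hta : ∀ i, |t * a i| ≤ 1 := fun i => by
    rw [abs_mul]
    exact (mul_le_mul htS (ha i) (abs_nonneg _) hS.le).trans hSm
  have hSa : ∀ i, |S * a i| ≤ 1 := fun i => by
    rw [abs_mul, abs_of_pos hS]
    exact (mul_le_mul_of_nonneg_left (ha i) hS.le).trans hSm
  have e1 := norm_expect_exp_sub_expect_exp_le
    (fun ω => t * ∑ i, a i * χ (Y ω i)) (fun v : ι → α => t * ∑ i, a i * χ (v i)) K (by
      intro k hk
      simp_rw [mul_pow]
      rw [← Finset.mul_expect, ← Finset.mul_expect]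
      rw [expect_sum_pow_eq (fun s hs => hY s (hs.trans hk)) (fun i c => a i * χ c)])
  -- Bounding the moment at the larger frequency `S` and scaling down to `t` gains the factor `(|t|
  -- / S) ^ (2 * K)`, which is small for large `K`.
  have e2 : (𝔼 v : ι → α, (t * ∑ i, a i * χ (v i)) ^ (2 * K) / ((2 * K).factorial : ℝ)) ≤
      (|t| / S) ^ (2 * K) * (2 * Real.exp (S ^ 2 * ∑ i, a i ^ 2)) := by
    have h2 := expect_sum_pow_div_factorial_le (α := α) h0 h1 hSa K
    have h3 : ∀ v : ι → α, (t * ∑ i, a i * χ (v i)) ^ (2 * K) / ((2 * K).factorial : ℝ) =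
        (|t| / S) ^ (2 * K) * ((∑ i, S * a i * χ (v i)) ^ (2 * K) / ((2 * K).factorial : ℝ)) := by
      intro v
      have : ∑ i, S * a i * χ (v i) = S * ∑ i, a i * χ (v i) := by
        rw [Finset.mul_sum]; exact Finset.sum_congr rfl fun i _ => by ring
      rw [this, mul_pow, mul_pow, div_pow, Even.pow_abs (even_two_mul K)]
      field_simp
    simp_rw [h3]
    rw [← Finset.mul_expect]
    refine mul_le_mul_of_nonneg_left (h2.trans_eq ?_) (by positivity)
    rw [Finset.mul_sum]
    simp_rw [mul_pow]
  have e3 := norm_expect_exp_sum_sub_exp_le (α := α) h0 h1 hta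
  have e4 : ∑ i, |t * a i| ^ 3 ≤ |t| ^ 3 * m * ∑ i, a i ^ 2 := by
    rw [Finset.mul_sum]
    refine Finset.sum_le_sum fun i _ => ?_
    rw [abs_mul, mul_pow, mul_assoc]
    refine mul_le_mul_of_nonneg_left ?_ (by positivity)
    calc |a i| ^ 3 = |a i| * a i ^ 2 := by rw [← sq_abs (a i)]; ring
      _ ≤ m * a i ^ 2 := mul_le_mul_of_nonneg_right (ha i) (sq_nonneg _)
  have e5 : ∀ v : ι → α, ∑ i, t * a i * χ (v i) = t * ∑ i, a i * χ (v i) := fun v => by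
    rw [Finset.mul_sum]; exact Finset.sum_congr rfl fun i _ => by ring
  have e6 : (∑ i, (t * a i) ^ 2) * (𝔼 c, χ c ^ 2) =
      t ^ 2 * ((∑ i, a i ^ 2) * (𝔼 c, χ c ^ 2)) := by
    simp_rw [mul_pow]; rw [← Finset.mul_sum]; ring
  simp_rw [e5] at e3
  rw [e6] at e3
  refine (norm_sub_le_norm_sub_add_norm_sub _ _ _).trans
    (add_le_add (e1.trans ?_) (e3.trans e4))
  calc _ ≤ 2 * ((|t| / S) ^ (2 * K) * (2 * Real.exp (S ^ 2 * ∑ i, a i ^ 2))) :=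
        mul_le_mul_of_nonneg_left e2 (by norm_num)
    _ = _ := by ring

end Independent

open IntermediateField

/-! ### Closed points and the joint law of the traces -/

section ClosedPoints

variable (p : ℕ) (F E : Type*) [Field F] [Field E] [Algebra F E]

/-- The closed points of the affine line over `F` whose residue field embeds in `E`, with relative
degree prime to `p`, represented by their minimal polynomials. -/
def ClosedPoint : Type _ :=
  {P : F[X] // ∃ x : E, ¬ p ∣ Module.finrank F⟮x⟯ E ∧ minpoly F x = P}

variable {p F E}

/-- A geometric point above a closed point. -/
def ClosedPoint.root (P : ClosedPoint p F E) : E := P.2.choose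

theorem ClosedPoint.not_dvd (P : ClosedPoint p F E) : ¬ p ∣ Module.finrank F⟮P.root⟯ E :=
  P.2.choose_spec.1

theorem ClosedPoint.minpoly_root (P : ClosedPoint p F E) : minpoly F P.root = P.1 :=
  P.2.choose_spec.2

/-- The degree of a closed point. -/
def ClosedPoint.degree (P : ClosedPoint p F E) : ℕ := P.1.natDegree

instance [Finite E] : Finite (ClosedPoint p F E) :=
  Finite.of_surjective
    (fun x : {x : E // ¬ p ∣ Module.finrank F⟮x⟯ E} => (⟨minpoly F x.1, x, x.2, rfl⟩ : ClosedPoint p F E))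
    fun ⟨_, x, hx, h⟩ => ⟨⟨x, hx⟩, Subtype.ext h⟩

variable (p F E) in
/-- The number of points of `E` whose relative degree is divisible by `p`. -/
def degenerateCount : ℕ := Nat.card {x : E // p ∣ Module.finrank F⟮x⟯ E}

variable [Finite E]

theorem natDegree_minpoly_mul_finrank (x : E) :
    (minpoly F x).natDegree * Module.finrank F⟮x⟯ E = Module.finrank F E := by
  rw [← IntermediateField.adjoin.finrank (IsIntegral.of_finite F x), Module.finrank_mul_finrank]

theorem natDegree_minpoly_pos (x : E) : 0 < (minpoly F x).natDegree :=
  minpoly.natDegree_pos (IsIntegral.of_finite F x)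

theorem finrank_adjoin_eq_of_minpoly_eq {x y : E} (h : minpoly F x = minpoly F y) :
    Module.finrank F⟮x⟯ E = Module.finrank F⟮y⟯ E := by
  have h1 := natDegree_minpoly_mul_finrank (F := F) x
  rw [h, ← natDegree_minpoly_mul_finrank (F := F) y] at h1
  exact Nat.eq_of_mul_eq_mul_left (natDegree_minpoly_pos y) h1

theorem natDegree_minpoly_le (x : E) : (minpoly F x).natDegree ≤ Module.finrank F E :=
  minpoly.natDegree_le x

theorem ClosedPoint.degree_le (P : ClosedPoint p F E) : P.degree ≤ Module.finrank F E := by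
  rw [ClosedPoint.degree, ← P.minpoly_root]
  exact natDegree_minpoly_le _

/-- Extensions of finite fields are separable and normal, so the minimal polynomial has as many
distinct roots in `E` as its degree. -/
theorem card_minpoly_eq [Finite F] (x₀ : E) :
    Nat.card {x : E // minpoly F x = minpoly F x₀} = (minpoly F x₀).natDegree := by
  classical
  have hint := IsIntegral.of_finite F x₀
  rw [← card_rootSet_eq_natDegree (K := E) (Algebra.IsSeparable.isSeparable F x₀)
    (Normal.splits inferInstance x₀), ← Nat.card_eq_fintype_card]
  refine Nat.card_congr (Equiv.subtypeEquivRight fun x => ?_)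
  rw [mem_rootSet]
  constructor
  · intro h
    exact ⟨minpoly.ne_zero hint, by rw [← h]; exact minpoly.aeval F x⟩
  · rintro ⟨-, h⟩
    exact (minpoly.eq_of_irreducible_of_monic (minpoly.irreducible hint) h
      (minpoly.monic hint)).symm

theorem sum_eq_sum_closedPoint [Finite F] [Fintype (ClosedPoint p F E)]
    [Fintype {x : E // ¬ p ∣ Module.finrank F⟮x⟯ E}] (g : E → ℝ)
    (hg : ∀ x y, minpoly F x = minpoly F y → g x = g y) :
    ∑ x : {x : E // ¬ p ∣ Module.finrank F⟮x⟯ E}, g x =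
      ∑ P : ClosedPoint p F E, P.degree * g P.root := by
  classical
  let κ : {x : E // ¬ p ∣ Module.finrank F⟮x⟯ E} → ClosedPoint p F E :=
    fun x => ⟨minpoly F x.1, x, x.2, rfl⟩
  rw [← Fintype.sum_fiberwise κ]
  refine Finset.sum_congr rfl fun P _ => ?_
  have h1 : ∀ x : {x // κ x = P}, g x = g P.root := fun x => hg _ _ (by
    rw [P.minpoly_root]; exact congrArg Subtype.val x.2)
  rw [Finset.sum_congr rfl fun x _ => h1 x, Finset.sum_const, nsmul_eq_mul, Finset.card_univ,
    ← Nat.card_eq_fintype_card, ClosedPoint.degree, ← P.minpoly_root, ← card_minpoly_eq]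
  congr 2
  refine Nat.card_congr
    { toFun := fun x => ⟨x.1.1, by rw [P.minpoly_root]; exact congrArg Subtype.val x.2⟩
      invFun := fun x => ⟨⟨x.1, by
        rw [finrank_adjoin_eq_of_minpoly_eq x.2]; exact P.not_dvd⟩,
        Subtype.ext (x.2.trans P.minpoly_root)⟩
      left_inv := fun _ => rfl
      right_inv := fun _ => rfl }

theorem sum_degree_add_degenerateCount [Finite F] [Fintype (ClosedPoint p F E)] :
    (∑ P : ClosedPoint p F E, (P.degree : ℝ)) + degenerateCount p F E = Nat.card E := by
  classical
  have := Fintype.ofFinite E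
  have h := sum_eq_sum_closedPoint (p := p) (F := F) (E := E) (fun _ => 1) (fun _ _ _ => rfl)
  simp only [mul_one] at h
  rw [← h, degenerateCount, Nat.card_eq_fintype_card, Nat.card_eq_fintype_card, Finset.sum_const,
    nsmul_eq_mul, mul_one, Finset.card_univ, add_comm, ← Nat.cast_add]
  rw [Fintype.card_subtype_compl, Nat.add_sub_of_le (Fintype.card_subtype_le _)]

/-- The decomposition of `N(f)` according to closed points. -/
theorem normCount_eq_sum [Fact p.Prime] [Finite F] [Algebra (ZMod p) F] [Algebra (ZMod p) E]
    [IsScalarTower (ZMod p) F E] [Fintype (ClosedPoint p F E)] (f : F[X])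
    (hf : f.natDegree.Coprime p) :
    normCount p E f = degenerateCount p F E +
      ∑ P : ClosedPoint p F E, P.degree * if traceEval p F P.root f = 0 then (1 : ℝ) else 0 := by
  classical
  have := Fintype.ofFinite E
  rw [← sum_eq_sum_closedPoint (p := p) (F := F) (E := E)
    (fun x => if traceEval p F x f = 0 then (1 : ℝ) else 0)
    (fun x y h => by simp only [traceEval_eq_of_minpoly_eq h])]
  rw [normCount_eq_card f hf, Nat.card_eq_fintype_card, Fintype.card_subtype, degenerateCount,
    Nat.card_eq_fintype_card, Finset.card_filter]
  push_cast
  rw [← Fintype.sum_subtype_add_sum_subtype (fun x : E => p ∣ Module.finrank F⟮x⟯ E)]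
  congr 1
  rw [Finset.sum_congr rfl fun x _ => if_pos (traceEval_eq_zero_of_dvd (p := p) (F := F) x.2 f)]
  simp

/-- Few closed points: the values of a random polynomial are independent and uniform. -/
theorem isEquidistributedOn_traceEval [Fact p.Prime] [Finite F] [Algebra (ZMod p) F]
    [Algebra (ZMod p) E] [IsScalarTower (ZMod p) F E] [DecidableEq (ClosedPoint p F E)] (d : ℕ)
    [Fintype (MonicOfDegree F d)] (s : Finset (ClosedPoint p F E))
    (hs : s.card * Module.finrank F E ≤ d) :
    IsEquidistributedOn
      (fun (f : MonicOfDegree F d) (P : ClosedPoint p F E) => traceEval p F P.root f.1) s := by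
  classical
  intro h
  have : Finite (degreeLT F d) := Finite.of_equiv (MonicOfDegree F d) (monicEquivDegreeLT d)
  have := Fintype.ofFinite (degreeLT F d)
  let φ : degreeLT F d →+ (s → ZMod p) :=
    { toFun := fun g P => traceEval p F P.1.root g
      map_zero' := funext fun P => by simp
      map_add' := fun a b => funext fun P => by simp }
  have hsum : ∑ P ∈ s, (minpoly F P.root).natDegree ≤ d := by
    refine le_trans ?_ hs
    rw [← smul_eq_mul, ← Finset.sum_const]
    exact Finset.sum_le_sum fun P _ => natDegree_minpoly_le _
  have hinj : Set.InjOn (fun P : ClosedPoint p F E => minpoly F P.root) s := by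
    intro P _ Q _ hPQ
    simp only [ClosedPoint.minpoly_root] at hPQ
    exact Subtype.ext hPQ
  -- Interpolating an element of trace one at one point and zero at the others reaches each
  -- coordinate vector. The map `φ` is additive, so natural multiples of these vectors give the
  -- rest.
  have hφ : Function.Surjective φ := by
    have h1 : ∀ P : s, ∃ g : degreeLT F d, φ g = Pi.single P 1 := by
      intro P
      obtain ⟨z, hz⟩ := exists_trace_eq_one (p := p) P.1.not_dvd
      obtain ⟨g, hg, hgP, hgQ⟩ := exists_aeval_eq_single s ClosedPoint.root hinj hsum P.2 z
      refine ⟨⟨g, hg⟩, funext fun Q => ?_⟩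
      change traceEval p F Q.1.root g = _
      rw [traceEval_apply]
      by_cases hQ : Q = P
      · subst hQ
        rw [hgP, hz, Pi.single_eq_same]
      · rw [hgQ Q.1 Q.2 (fun h => hQ (Subtype.ext h)), map_zero, Pi.single_eq_of_ne hQ]
    choose g hg using h1
    intro v
    refine ⟨∑ P, (v P).val • g P, ?_⟩
    rw [map_sum]
    simp_rw [map_nsmul, hg]
    funext Q
    rw [Finset.sum_apply, Finset.sum_eq_single Q]
    · simp
    · intro P _ hPQ
      simp [Pi.single_eq_of_ne hPQ.symm]
    · simp
  -- The monic polynomials form the translate by `X ^ d` of the group of polynomials of degree less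
  -- than `d`.
  rw [← expect_comp_of_surjective φ hφ (fun P => traceEval p F P.1.root (X ^ d)) h]
  refine Fintype.expect_equiv (ι := MonicOfDegree F d) (monicEquivDegreeLT d) _ _ fun f => ?_
  obtain ⟨f, hf, hfd⟩ := f
  have key : f = X ^ d + f.eraseLead := by
    conv_lhs => rw [← eraseLead_add_monomial_natDegree_leadingCoeff f]
    rw [hf.leadingCoeff, hfd, monomial_one_right_eq_X_pow, add_comm]
  congr 1
  funext P
  change traceEval p F P.1.root f =
    traceEval p F P.1.root (X ^ d) + traceEval p F P.1.root f.eraseLead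
  rw [← map_add, ← key]

end ClosedPoints

/-! ### Degenerate points and the sum of squared degrees -/

section Counting

variable {p : ℕ} {F E : Type*} [Field F] [Field E] [Algebra F E] [Finite E]

theorem pow_card_pow_eq_self {x : E} {m : ℕ} (h : (minpoly F x).natDegree ∣ m) :
    x ^ Nat.card F ^ m = x := by
  obtain ⟨k, rfl⟩ := h
  have := Fintype.ofFinite F⟮x⟯
  have h1 : Nat.card F⟮x⟯ = Nat.card F ^ (minpoly F x).natDegree := by
    rw [Module.natCard_eq_pow_finrank (K := F),
      IntermediateField.adjoin.finrank (IsIntegral.of_finite F x)]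
  have h2 := FiniteField.pow_card_pow k (AdjoinSimple.gen F x)
  rw [← Nat.card_eq_fintype_card, h1, ← pow_mul] at h2
  exact congrArg Subtype.val h2

theorem card_pow_eq_self_le {F E : Type*} [Field F] [Finite F] [Field E] {m : ℕ} (hm : m ≠ 0) :
    Nat.card {x : E // x ^ Nat.card F ^ m = x} ≤ Nat.card F ^ m := by
  classical
  have h1 : 1 < Nat.card F ^ m := one_lt_pow₀ Finite.one_lt_card hm
  have h2 := FiniteField.X_pow_card_sub_X_natDegree_eq E h1
  have h3 := FiniteField.X_pow_card_sub_X_ne_zero E h1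
  have h4 : ∀ x : E, x ^ Nat.card F ^ m = x ↔
      x ∈ (X ^ Nat.card F ^ m - X : E[X]).roots.toFinset := by
    intro x
    rw [Multiset.mem_toFinset, mem_roots h3]
    simp [sub_eq_zero]
  rw [Nat.card_congr (Equiv.subtypeEquivRight h4), Nat.card_eq_fintype_card, Fintype.card_coe]
  exact (Multiset.toFinset_card_le _).trans ((card_roots' _).trans h2.le)

theorem degenerateCount_eq_zero (h : (Module.finrank F E).Coprime p) (hp : p.Prime) :
    degenerateCount p F E = 0 := by
  rw [degenerateCount, Nat.card_eq_zero]
  left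
  refine ⟨fun x => ?_⟩
  have h1 : p ∣ Module.finrank F E := by
    rw [← natDegree_minpoly_mul_finrank x.1]
    exact x.2.mul_left _
  exact hp.one_lt.ne' (Nat.dvd_one.1 (h ▸ Nat.dvd_gcd h1 dvd_rfl))

variable [Finite F]

/-- When `[E : F] = p k`, the prime `p` divides `[E : F(x)]` exactly when the degree of `x` divides
`k`, that is, when `x` lies in the subfield with `q ^ k` elements. -/
theorem degenerateCount_eq [Fact p.Prime] [CharP F p] {k : ℕ} (hk : k ≠ 0)
    (h : Module.finrank F E = p * k) : degenerateCount p F E = Nat.card F ^ k := by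
  have hp : p.Prime := Fact.out
  apply le_antisymm
  · refine le_trans ?_ (card_pow_eq_self_le (F := F) (E := E) hk)
    refine Nat.card_mono (Set.toFinite _) fun x hx => ?_
    refine pow_card_pow_eq_self ?_
    obtain ⟨j, hj⟩ := hx
    refine ⟨j, ?_⟩
    have := natDegree_minpoly_mul_finrank (F := F) x
    rw [hj, h] at this
    refine Nat.eq_of_mul_eq_mul_left hp.pos ?_
    linarith
  · have : NeZero k := ⟨hk⟩
    obtain ⟨φ⟩ := FiniteField.nonempty_algHom_of_finrank_dvd (F := F)
      (K := FiniteField.Extension F p k) (L := E) (by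
        rw [FiniteField.finrank_extension, h]; exact dvd_mul_left _ _)
    rw [← FiniteField.natCard_extension F p k]
    refine Nat.card_le_card_of_injective
      (fun z => (⟨φ z, ?_⟩ : {x : E // p ∣ Module.finrank F⟮x⟯ E})) fun z w hzw =>
        φ.injective (congrArg Subtype.val hzw)
    have h1 := natDegree_minpoly_mul_finrank (F := F) (φ z)
    have h2 := natDegree_minpoly_mul_finrank (F := F) z
    rw [minpoly.algHom_eq φ φ.injective, h] at h1
    rw [FiniteField.finrank_extension] at h2
    refine ⟨Module.finrank F⟮z⟯ (FiniteField.Extension F p k), ?_⟩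
    refine Nat.eq_of_mul_eq_mul_left (natDegree_minpoly_pos (F := F) z) ?_
    rw [h1, mul_left_comm, h2]

/-- An element of degree `m < r` is a root of `X ^ q ^ m - X`, and there are fewer than `r` such
`m`. -/
theorem card_natDegree_lt_le {r : ℕ} (hr : Module.finrank F E = r) :
    Nat.card {x : E // (minpoly F x).natDegree ≠ r} ≤ r * Nat.card F ^ (r - 1) := by
  classical
  have := Fintype.ofFinite E
  have h1 : (Finset.univ.filter fun x : E => (minpoly F x).natDegree ≠ r) ⊆
      (Finset.Ico 1 r).biUnion fun m => Finset.univ.filter fun x : E => x ^ Nat.card F ^ m = x := by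
    intro x hx
    rw [Finset.mem_filter] at hx
    rw [Finset.mem_biUnion]
    refine ⟨(minpoly F x).natDegree, Finset.mem_Ico.2 ⟨natDegree_minpoly_pos x, ?_⟩, ?_⟩
    · exact lt_of_le_of_ne (hr ▸ natDegree_minpoly_le x) hx.2
    · simpa using pow_card_pow_eq_self dvd_rfl
  rw [Nat.card_eq_fintype_card, Fintype.card_subtype]
  refine (Finset.card_le_card h1).trans (Finset.card_biUnion_le.trans ?_)
  calc _ ≤ ∑ m ∈ Finset.Ico 1 r, Nat.card F ^ (r - 1) := Finset.sum_le_sum fun m hm => by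
        rw [Finset.mem_Ico] at hm
        have h2 := card_pow_eq_self_le (F := F) (E := E) (m := m) (by omega)
        rw [Nat.card_eq_fintype_card, Fintype.card_subtype] at h2
        exact h2.trans (Nat.pow_le_pow_right Nat.card_pos (by omega))
    _ ≤ _ := by
        rw [Finset.sum_const, smul_eq_mul, Nat.card_Ico]
        exact Nat.mul_le_mul_right _ (Nat.sub_le _ _)

theorem sum_degree_sq_le [Fintype (ClosedPoint p F E)] {r : ℕ} (hr : Module.finrank F E = r) :
    ∑ P : ClosedPoint p F E, (P.degree : ℝ) ^ 2 ≤ r * (Nat.card F : ℝ) ^ r := by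
  have h := sum_degree_add_degenerateCount (p := p) (F := F) (E := E)
  rw [Module.natCard_eq_pow_finrank (K := F), hr, Nat.cast_pow] at h
  rw [← h]
  calc ∑ P : ClosedPoint p F E, (P.degree : ℝ) ^ 2 ≤ ∑ P : ClosedPoint p F E, (r : ℝ) * P.degree :=
        Finset.sum_le_sum fun P _ => by
          rw [sq]
          exact mul_le_mul_of_nonneg_right (Nat.cast_le.2 (hr ▸ P.degree_le)) (Nat.cast_nonneg _)
    _ = r * ∑ P : ClosedPoint p F E, (P.degree : ℝ) := (Finset.mul_sum _ _ _).symm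
    _ ≤ _ := mul_le_mul_of_nonneg_left (le_add_of_nonneg_right (Nat.cast_nonneg _))
        (Nat.cast_nonneg _)

/-- Keep only the elements of degree `r`. They generate `E`, so their relative degree is one and
they are not degenerate. -/
theorem le_sum_degree_sq [Fintype (ClosedPoint p F E)] (hp : p ≠ 1) {r : ℕ}
    (hr : Module.finrank F E = r) :
    r * ((Nat.card F : ℝ) ^ r - r * (Nat.card F : ℝ) ^ (r - 1)) ≤
      ∑ P : ClosedPoint p F E, (P.degree : ℝ) ^ 2 := by
  classical
  have := Fintype.ofFinite E
  have h := sum_eq_sum_closedPoint (p := p) (F := F) (E := E)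
    (fun x => ((minpoly F x).natDegree : ℝ)) (fun x y h => by simp only [h])
  have h1 : ∀ P : ClosedPoint p F E, (P.degree : ℝ) * (minpoly F P.root).natDegree =
      (P.degree : ℝ) ^ 2 := fun P => by
    rw [P.minpoly_root, ClosedPoint.degree, sq]
  simp only [h1] at h
  rw [← h]
  have h2 := card_natDegree_lt_le hr
  rw [Nat.card_eq_fintype_card, Fintype.card_subtype] at h2
  have h3 := Finset.card_filter_add_card_filter_not (s := Finset.univ)
    (fun x : E => (minpoly F x).natDegree = r)
  rw [Finset.card_univ, ← Nat.card_eq_fintype_card, Module.natCard_eq_pow_finrank (K := F),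
    hr] at h3
  have h2' : ((Finset.univ.filter fun x : E => (minpoly F x).natDegree ≠ r).card : ℝ) ≤
      r * (Nat.card F : ℝ) ^ (r - 1) := by exact_mod_cast h2
  have h3' : ((Finset.univ.filter fun x : E => (minpoly F x).natDegree = r).card : ℝ) +
      (Finset.univ.filter fun x : E => (minpoly F x).natDegree ≠ r).card =
      (Nat.card F : ℝ) ^ r := by exact_mod_cast h3
  calc (r : ℝ) * ((Nat.card F : ℝ) ^ r - r * (Nat.card F : ℝ) ^ (r - 1))
      ≤ r * (Finset.univ.filter fun x : E => (minpoly F x).natDegree = r).card :=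
        mul_le_mul_of_nonneg_left (by linarith) (Nat.cast_nonneg _)
    _ = ∑ x ∈ Finset.univ.filter (fun x : E => (minpoly F x).natDegree = r),
          ((minpoly F x).natDegree : ℝ) := by
        rw [Finset.sum_congr rfl fun x hx => by rw [(Finset.mem_filter.1 hx).2], Finset.sum_const,
          nsmul_eq_mul, mul_comm]
    _ ≤ ∑ x ∈ Finset.univ.filter (fun x : E => ¬ p ∣ Module.finrank F⟮x⟯ E),
          ((minpoly F x).natDegree : ℝ) := by
        refine Finset.sum_le_sum_of_subset_of_nonneg (fun x hx => ?_)
          fun _ _ _ => Nat.cast_nonneg _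
        rw [Finset.mem_filter] at hx ⊢
        refine ⟨hx.1, fun hdvd => hp ?_⟩
        have h4 := natDegree_minpoly_mul_finrank (F := F) x
        rw [hr, ← hx.2] at h4
        have h5 : Module.finrank F⟮x⟯ E = 1 :=
          Nat.eq_of_mul_eq_mul_left (natDegree_minpoly_pos (F := F) x) (by rw [h4, mul_one])
        exact Nat.dvd_one.1 (h5 ▸ hdvd)
    _ = _ := Finset.sum_subtype _ (fun x => by simp) _

end Counting

open scoped Topology

/-! ### Convergence in distribution from characteristic functions -/

section Levy

instance (F : Type*) [Field F] (d : ℕ) : DiscreteMeasurableSpace (MonicOfDegree F d) :=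
  ⟨fun _ => trivial⟩

theorem integral_uniformOn_univ {Ω : Type*} [Fintype Ω] [Nonempty Ω] [MeasurableSpace Ω]
    [DiscreteMeasurableSpace Ω] (g : Ω → ℂ) :
    ∫ ω, g ω ∂(uniformOn (Set.univ : Set Ω)) = 𝔼 ω, g ω := by
  rw [integral_fintype .of_finite, Fintype.expect_eq_sum_div_card, Finset.sum_div]
  refine Finset.sum_congr rfl fun ω _ => ?_
  rw [Measure.real, uniformOn_univ, Measure.count_singleton, ENNReal.toReal_div, Complex.real_smul]
  simp [div_eq_inv_mul]

theorem charFun_map_uniformOn_univ {Ω : Type*} [Fintype Ω] [Nonempty Ω] [MeasurableSpace Ω]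
    [DiscreteMeasurableSpace Ω] (X : Ω → ℝ) (t : ℝ) :
    charFun ((uniformOn (Set.univ : Set Ω)).map X) t =
      𝔼 ω, Complex.exp ((t * X ω : ℝ) * Complex.I) := by
  rw [charFun_apply_real, integral_map (Measurable.of_discrete).aemeasurable (by fun_prop),
    integral_uniformOn_univ]
  push_cast
  rfl

/-- Lévy's theorem for convergence to the standard Gaussian along a countably generated filter. -/
theorem tendstoInDistribution_of_charFun {ι : Type*} {Ω : ι → Type*}
    [∀ i, MeasurableSpace (Ω i)] {μ : ∀ i, Measure (Ω i)} [∀ i, IsProbabilityMeasure (μ i)]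
    {l : Filter ι} [l.IsCountablyGenerated] {X : ∀ i, Ω i → ℝ} (hX : ∀ i, Measurable (X i))
    (h : ∀ t : ℝ, Tendsto (fun i => charFun ((μ i).map (X i)) t) l
      (𝓝 (Complex.exp ((-(t ^ 2 / 2) : ℝ))))) :
    TendstoInDistribution X l (id : ℝ → ℝ) μ (gaussianReal 0 1) where
  forall_aemeasurable i := (hX i).aemeasurable
  aemeasurable_limit := aemeasurable_id
  tendsto := by
    -- Countable generation of the filter reduces the claim to sequences, to which Lévy's theorem
    -- applies.
    refine tendsto_of_seq_tendsto fun u hu => ?_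
    refine ProbabilityMeasure.tendsto_of_tendsto_charFun fun t => ?_
    have h1 : charFun ((gaussianReal 0 1).map id) t = Complex.exp ((-(t ^ 2 / 2) : ℝ)) := by
      rw [Measure.map_id, charFun_gaussianReal]
      congr 1
      push_cast
      simp
    simp only [ProbabilityMeasure.coe_mk, h1]
    exact (h t).comp hu

end Levy

/-! ### The centred count as a weighted sum -/

section Fluctuation

variable (p : ℕ) [Fact p.Prime]

/-- The centered indicator function of zero. -/
def centeredIndicator (c : ZMod p) : ℝ := (if c = 0 then 1 else 0) - 1 / p

theorem expect_indicator : 𝔼 c : ZMod p, (if c = 0 then (1 : ℝ) else 0) = 1 / p := by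
  rw [Fintype.expect_eq_sum_div_card, ZMod.card, Finset.sum_ite_eq' Finset.univ (0 : ZMod p)]
  simp

theorem expect_centeredIndicator : 𝔼 c, centeredIndicator p c = 0 := by
  unfold centeredIndicator
  rw [Finset.expect_sub_distrib, expect_indicator, Fintype.expect_const, sub_self]

theorem abs_centeredIndicator_le (c : ZMod p) : |centeredIndicator p c| ≤ 1 := by
  have h1 : (1 : ℝ) ≤ p := Nat.one_le_cast.2 (Fact.out : p.Prime).one_lt.le
  have h2 : (0 : ℝ) < 1 / p := by positivity
  have h3 : 1 / (p : ℝ) ≤ 1 := by rw [div_le_one (by linarith)]; exact h1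
  unfold centeredIndicator
  rw [abs_le]
  split_ifs <;> constructor <;> linarith

theorem expect_centeredIndicator_sq :
    𝔼 c, centeredIndicator p c ^ 2 = 1 / p * (1 - 1 / p) := by
  have h : ∀ c, centeredIndicator p c ^ 2 =
      (1 - 2 / p) * (if c = 0 then (1 : ℝ) else 0) + 1 / p ^ 2 := by
    intro c
    unfold centeredIndicator
    split_ifs <;> ring
  simp_rw [h]
  rw [Finset.expect_add_distrib, ← Finset.mul_expect, expect_indicator, Fintype.expect_const]
  ring

variable {p} {F E : Type*} [Field F] [Field E] [Algebra F E] [Finite F] [Finite E]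
  [Algebra (ZMod p) F] [Algebra (ZMod p) E] [IsScalarTower (ZMod p) F E]
  [Fintype (ClosedPoint p F E)]

/-- The mean is the number of degenerate points plus `1 / p` times the number of the others,
rewritten with the total number of points of `E`. -/
theorem normCount_sub_mean (f : F[X]) (hf : f.natDegree.Coprime p) :
    normCount p E f - (degenerateCount p F E * (1 - 1 / p) + Nat.card E / p) =
      ∑ P : ClosedPoint p F E, P.degree * centeredIndicator p (traceEval p F P.root f) := by
  rw [normCount_eq_sum f hf, ← sum_degree_add_degenerateCount (p := p) (F := F) (E := E)]
  simp only [centeredIndicator, mul_sub, Finset.sum_sub_distrib, ← Finset.sum_mul]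
  ring

/-- The distance of the characteristic function of the centered count to a Gaussian one. -/
theorem norm_expect_exp_normCount_sub_le {d K : ℕ} [Fintype (MonicOfDegree F d)]
    (hd : d.Coprime p) (hK : 2 * K * Module.finrank F E ≤ d) {σ S t β : ℝ} (hσ : 0 ≤ σ)
    (hS : 0 < S) (hσS : S * (σ * Module.finrank F E) ≤ 1) (htS : |t| ≤ S)
    (hβ : β = degenerateCount p F E * (1 - 1 / p) + Nat.card E / p) :
    ‖(𝔼 f : MonicOfDegree F d,
        Complex.exp ((t * (σ * (normCount p E f.1 - β)) : ℝ) * Complex.I)) -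
      Complex.exp ((-(t ^ 2 * ((∑ P : ClosedPoint p F E, (σ * P.degree) ^ 2) *
        (1 / p * (1 - 1 / p))) / 2) : ℝ))‖ ≤
      4 * (|t| / S) ^ (2 * K) * Real.exp (S ^ 2 * ∑ P : ClosedPoint p F E, (σ * P.degree) ^ 2) +
        |t| ^ 3 * (σ * Module.finrank F E) *
          ∑ P : ClosedPoint p F E, (σ * P.degree) ^ 2 := by
  classical
  have h := norm_expect_exp_sum_sub_exp_le_of_equidistributed
    (expect_centeredIndicator p) (abs_centeredIndicator_le p)
    (a := fun P : ClosedPoint p F E => σ * P.degree)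
    (Y := fun (f : MonicOfDegree F d) (P : ClosedPoint p F E) => traceEval p F P.root f.1)
    (K := K) (t := t) (S := S) (m := σ * Module.finrank F E)
    (fun s hs => isEquidistributedOn_traceEval d s ((Nat.mul_le_mul_right _ hs).trans hK))
    (fun P => by
      rw [abs_of_nonneg (by positivity)]
      exact mul_le_mul_of_nonneg_left (Nat.cast_le.2 P.degree_le) hσ) hS hσS htS
  rw [expect_centeredIndicator_sq] at h
  refine le_of_eq_of_le ?_ h
  congr 2
  refine Finset.expect_congr rfl fun f _ => ?_
  obtain ⟨f, hf, hfd⟩ := f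
  change Complex.exp ((t * (σ * (normCount p E f - β)) : ℝ) * Complex.I) = Complex.exp
    ((t * ∑ P : ClosedPoint p F E, σ * P.degree * centeredIndicator p (traceEval p F P.root f) : ℝ) *
      Complex.I)
  rw [hβ, normCount_sub_mean f (hfd ▸ hd), Finset.mul_sum]
  simp only [mul_assoc]

end Fluctuation

/-! ### Normalisation and the limit -/

section Limit

variable (p r : ℕ) [Fact p.Prime]

/-- The normalising factor of the fluctuations of the number of points. -/
def scale (n : ℕ) : ℝ :=
  (p : ℝ) ^ (1 / 2 : ℝ) * ((1 - 1 / (p : ℝ)) * r) ^ (-1 / 2 : ℝ) * ((p : ℝ) ^ n) ^ (-(r : ℝ) / 2)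

theorem tendsto_pow_atTop : Tendsto (fun n : ℕ => (p : ℝ) ^ n) atTop atTop :=
  tendsto_pow_atTop_atTop_of_one_lt (Nat.one_lt_cast.2 (Fact.out : p.Prime).one_lt)

/-- The scale tends to zero, even after multiplication by a small power of `q`. -/
theorem tendsto_scale_mul_pow {k : ℕ} (hk : 2 * k < r) :
    Tendsto (fun n => scale p r n * ((p : ℝ) ^ n) ^ k) atTop (𝓝 0) := by
  have hp : (0 : ℝ) < p := Nat.cast_pos.2 (Fact.out : p.Prime).pos
  have hk' : 0 < (r : ℝ) / 2 - k := by
    have : (2 * k : ℝ) < r := by exact_mod_cast hk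
    linarith
  have h := ((tendsto_rpow_neg_atTop hk').comp (tendsto_pow_atTop p)).const_mul
    ((p : ℝ) ^ (1 / 2 : ℝ) * ((1 - 1 / (p : ℝ)) * r) ^ (-1 / 2 : ℝ))
  rw [mul_zero] at h
  refine h.congr fun n => ?_
  have hq : (0 : ℝ) < (p : ℝ) ^ n := by positivity
  rw [scale, ← Real.rpow_natCast ((p : ℝ) ^ n) k, mul_assoc (_ * _) _ _, ← Real.rpow_add hq]
  simp only [Function.comp]
  congr 2
  ring

variable [NeZero r]

theorem one_sub_inv_mul_pos : 0 < (1 - 1 / (p : ℝ)) * r := by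
  have h1 : (1 : ℝ) < p := Nat.one_lt_cast.2 (Fact.out : p.Prime).one_lt
  have h2 : (0 : ℝ) < r := Nat.cast_pos.2 (NeZero.pos r)
  have h3 : 1 / (p : ℝ) < 1 := by rw [div_lt_one (by linarith)]; exact h1
  exact mul_pos (by linarith) h2

theorem scale_nonneg (n : ℕ) : 0 ≤ scale p r n := by
  have := (one_sub_inv_mul_pos p r).le
  unfold scale
  positivity

/-- The scale is the inverse square root of the asymptotic variance `(1 / p) (1 - 1 / p) r q ^ r`.
-/
theorem scale_sq_mul (n : ℕ) :
    scale p r n ^ 2 * (1 / p * (1 - 1 / p)) * (r * ((p : ℝ) ^ n) ^ r) = 1 := by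
  have hp : (0 : ℝ) < p := Nat.cast_pos.2 (Fact.out : p.Prime).pos
  have h1 := one_sub_inv_mul_pos p r
  have hq : (0 : ℝ) < (p : ℝ) ^ n := by positivity
  have e1 : ((p : ℝ) ^ (1 / 2 : ℝ)) ^ 2 = p := by
    rw [← Real.rpow_natCast, ← Real.rpow_mul hp.le]; norm_num
  have e2 : (((1 - 1 / (p : ℝ)) * r) ^ (-1 / 2 : ℝ)) ^ 2 = ((1 - 1 / (p : ℝ)) * r)⁻¹ := by
    rw [← Real.rpow_natCast, ← Real.rpow_mul h1.le, ← Real.rpow_neg_one]; norm_num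
  have e3 : (((p : ℝ) ^ n) ^ (-(r : ℝ) / 2)) ^ 2 = (((p : ℝ) ^ n) ^ r)⁻¹ := by
    rw [← Real.rpow_natCast, ← Real.rpow_mul hq.le, ← Real.rpow_natCast ((p : ℝ) ^ n) r,
      ← Real.rpow_neg hq.le]
    congr 1
    push_cast
    ring
  unfold scale
  rw [mul_pow, mul_pow, e1, e2, e3]
  have h2 := h1.ne'
  have h3 : (1 - 1 / (p : ℝ)) ≠ 0 := left_ne_zero_of_mul h2
  have h4 : (r : ℝ) ≠ 0 := right_ne_zero_of_mul h2
  have h5 : (((p : ℝ) ^ n) ^ r) ≠ 0 := by positivity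
  rw [mul_inv]
  generalize 1 - 1 / (p : ℝ) = A at *
  have h6 := hp.ne'
  field_simp

theorem tendsto_scale : Tendsto (scale p r) atTop (𝓝 0) := by
  simpa using tendsto_scale_mul_pow p r (k := 0) (by simpa using NeZero.pos r)

instance (n : ℕ) : Fintype (ClosedPoint p (GaloisField p n)
    (FiniteField.Extension (GaloisField p n) p r)) := Fintype.ofFinite _

instance (F : Type*) [Field F] [Finite F] (d : ℕ) : Fintype (MonicOfDegree F d) :=
  Fintype.ofFinite _

/-- The normalised sum of the squares of the degrees of the closed points. -/
def weight (n : ℕ) : ℝ :=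
  ∑ P : ClosedPoint p (GaloisField p n) (FiniteField.Extension (GaloisField p n) p r),
    (scale p r n * P.degree) ^ 2

theorem finrank_extension_galoisField (n : ℕ) :
    Module.finrank (GaloisField p n) (FiniteField.Extension (GaloisField p n) p r) = r :=
  FiniteField.finrank_extension _ _ _

/-- The normalised variance never exceeds its limit, which bounds the exponential moments uniformly
in `n`. The case `n = 0` is excluded because the cardinality formula fails there. -/
theorem weight_mul_le {n : ℕ} (hn : n ≠ 0) : weight p r n * (1 / p * (1 - 1 / p)) ≤ 1 := by
  have h := sum_degree_sq_le (p := p) (finrank_extension_galoisField p r n)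
  rw [GaloisField.card p n hn] at h
  push_cast at h
  have hv : 0 ≤ 1 / (p : ℝ) * (1 - 1 / p) := by
    rw [← expect_centeredIndicator_sq]; exact Finset.expect_nonneg fun _ _ => sq_nonneg _
  refine le_of_le_of_eq ?_ (scale_sq_mul p r n)
  rw [weight]
  simp_rw [mul_pow]
  rw [← Finset.mul_sum, mul_right_comm]
  exact mul_le_mul_of_nonneg_left h (mul_nonneg (sq_nonneg _) hv)

theorem le_weight_mul {n : ℕ} (hn : n ≠ 0) :
    1 - r * ((p : ℝ) ^ n)⁻¹ ≤ weight p r n * (1 / p * (1 - 1 / p)) := by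
  have h := le_sum_degree_sq (p := p) (Fact.out : p.Prime).ne_one
    (finrank_extension_galoisField p r n)
  rw [GaloisField.card p n hn] at h
  push_cast at h
  have hv : 0 ≤ 1 / (p : ℝ) * (1 - 1 / p) := by
    rw [← expect_centeredIndicator_sq]; exact Finset.expect_nonneg fun _ _ => sq_nonneg _
  have hq : (p : ℝ) ^ n ≠ 0 := pow_ne_zero _ (Nat.cast_ne_zero.2 (Fact.out : p.Prime).ne_zero)
  have e : r * (((p : ℝ) ^ n) ^ r - r * ((p : ℝ) ^ n) ^ (r - 1)) =
      r * ((p : ℝ) ^ n) ^ r * (1 - r * ((p : ℝ) ^ n)⁻¹) := by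
    have : ((p : ℝ) ^ n) ^ r = ((p : ℝ) ^ n) ^ (r - 1) * (p : ℝ) ^ n := by
      rw [← pow_succ, Nat.sub_add_cancel (NeZero.one_le)]
    rw [this]
    field_simp
  rw [e] at h
  rw [weight]
  simp_rw [mul_pow]
  rw [← Finset.mul_sum, mul_right_comm]
  refine le_trans (le_of_eq ?_) (mul_le_mul_of_nonneg_left h (mul_nonneg (sq_nonneg _) hv))
  rw [← mul_assoc, scale_sq_mul, one_mul]

theorem tendsto_weight_mul :
    Tendsto (fun n => weight p r n * (1 / p * (1 - 1 / p))) atTop (𝓝 1) := by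
  have h1 : Tendsto (fun n : ℕ => 1 - r * ((p : ℝ) ^ n)⁻¹) atTop (𝓝 1) := by
    simpa using ((tendsto_pow_atTop p).inv_tendsto_atTop.const_mul (r : ℝ)).const_sub 1
  refine tendsto_of_tendsto_of_tendsto_of_le_of_le' h1 tendsto_const_nhds ?_ ?_
  · filter_upwards [eventually_ne_atTop 0] with n hn using le_weight_mul p r hn
  · filter_upwards [eventually_ne_atTop 0] with n hn using weight_mul_le p r hn

/-- The main term of the mean of the number of points. -/
def mean (n : ℕ) : ℝ :=
  degenerateCount p (GaloisField p n) (FiniteField.Extension (GaloisField p n) p r) *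
    (1 - 1 / p) + ((p : ℝ) ^ n) ^ r / p

theorem tendsto_expect_exp (t : ℝ) :
    Tendsto (fun i : ℕ × ℕ => 𝔼 f : MonicOfDegree (GaloisField p i.1) i.2,
        Complex.exp ((t * (scale p r i.1 * (N p r i.1 i.2 f - mean p r i.1)) : ℝ) * Complex.I))
      (atTop ×ˢ (atTop ⊓ 𝓟 {d : ℕ | d.Coprime p})) (𝓝 (Complex.exp ((-(t ^ 2 / 2) : ℝ)))) := by
  set v : ℝ := 1 / p * (1 - 1 / p) with hv
  have hv0 : 0 < v := by
    have h1 := one_sub_inv_mul_pos p 1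
    rw [Nat.cast_one, mul_one] at h1
    have : (0 : ℝ) < p := Nat.cast_pos.2 (Fact.out : p.Prime).pos
    exact mul_pos (by positivity) h1
  -- This choice makes `|t| / S` at most `1 / 2`, and keeps `S` positive when `t = 0`.
  set S : ℝ := 2 * |t| + 1
  have hS : 0 < S := by positivity
  have htS : |t| ≤ S := by simp only [S]; linarith [abs_nonneg t]
  have htS2 : |t| / S ≤ 1 / 2 := by
    rw [div_le_div_iff₀ hS two_pos]; simp only [S]; linarith [abs_nonneg t]
  set M : ℝ := Real.exp (S ^ 2 * v⁻¹)
  have hweight : ∀ n, n ≠ 0 → weight p r n ≤ v⁻¹ := fun n hn => by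
    rw [← one_div, le_div_iff₀ hv0]; exact weight_mul_le p r hn
  have hW : Tendsto (fun n => Complex.exp ((-(t ^ 2 * (weight p r n * v) / 2) : ℝ))) atTop
      (𝓝 (Complex.exp ((-(t ^ 2 / 2) : ℝ)))) := by
    have hc : Continuous fun w : ℝ => Complex.exp ((-(t ^ 2 * w / 2) : ℝ)) := by fun_prop
    have h := (hc.tendsto 1).comp (tendsto_weight_mul p r)
    rw [mul_one] at h
    exact h
  have herr : Tendsto (fun n => |t| ^ 3 * (scale p r n * r) * v⁻¹) atTop (𝓝 0) := by
    simpa using (((tendsto_scale p r).mul_const (r : ℝ)).const_mul (|t| ^ 3)).mul_const v⁻¹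
  have hsmall : ∀ᶠ n in atTop, S * (scale p r n * r) ≤ 1 := by
    have : Tendsto (fun n => S * (scale p r n * r)) atTop (𝓝 0) := by
      simpa using ((tendsto_scale p r).mul_const (r : ℝ)).const_mul S
    exact this.eventually (eventually_le_nhds one_pos)
  rw [Metric.tendsto_nhds]
  intro ε hε
  -- `K` is fixed before `n` and `d`, as `M` involves neither. What remains is one condition on `n`
  -- and one on `d`, as the product filter requires.
  obtain ⟨K, hK⟩ : ∃ K : ℕ, 4 * (1 / 2 : ℝ) ^ (2 * K) * M < ε / 3 := by
    have h1 : Tendsto (fun K : ℕ => 4 * (1 / 2 : ℝ) ^ (2 * K) * M) atTop (𝓝 0) := by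
      have h2 := tendsto_pow_atTop_nhds_zero_of_lt_one (r := (1 / 2 : ℝ)) (by norm_num)
        (by norm_num)
      have h3 : Tendsto (fun K : ℕ => 2 * K) atTop atTop :=
        tendsto_id.const_mul_atTop' two_pos
      simpa using ((h2.comp h3).const_mul 4).mul_const M
    exact (h1.eventually (gt_mem_nhds (by positivity))).exists
  have hn : ∀ᶠ n : ℕ in atTop, n ≠ 0 ∧ S * (scale p r n * r) ≤ 1 ∧
      |t| ^ 3 * (scale p r n * r) * v⁻¹ < ε / 3 ∧
      dist (Complex.exp ((-(t ^ 2 * (weight p r n * v) / 2) : ℝ)))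
        (Complex.exp ((-(t ^ 2 / 2) : ℝ))) < ε / 3 := by
    filter_upwards [eventually_ne_atTop 0, hsmall,
      herr.eventually (gt_mem_nhds (show (0 : ℝ) < ε / 3 by positivity)),
      Metric.tendsto_nhds.1 hW (ε / 3) (by positivity)] with n h1 h2 h3 h4
    exact ⟨h1, h2, h3, h4⟩
  have hd : ∀ᶠ d : ℕ in atTop ⊓ 𝓟 {d : ℕ | d.Coprime p}, 2 * K * r ≤ d ∧ d.Coprime p :=
    ((eventually_ge_atTop _).filter_mono inf_le_left).and
      (eventually_inf_principal.2 (Eventually.of_forall fun _ h => h))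
  filter_upwards [hn.prod_mk hd] with ⟨n, d⟩ ⟨⟨hn0, hsm, he, hw⟩, hdK, hdp⟩
  dsimp only at hn0 hsm he hw hdK hdp ⊢
  have hcard : (Nat.card (FiniteField.Extension (GaloisField p n) p r) : ℝ) =
      ((p : ℝ) ^ n) ^ r := by
    rw [FiniteField.natCard_extension, GaloisField.card p n hn0]
    push_cast; rfl
  have key := norm_expect_exp_normCount_sub_le (p := p) (F := GaloisField p n)
    (E := FiniteField.Extension (GaloisField p n) p r) (d := d) (K := K) (σ := scale p r n)
    (S := S) (t := t) (β := mean p r n) hdp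
    (by rw [finrank_extension_galoisField]; exact hdK) (scale_nonneg p r n) hS
    (by rw [finrank_extension_galoisField]; exact hsm) htS (by rw [hcard, mean])
  rw [finrank_extension_galoisField] at key
  change ‖(𝔼 f : MonicOfDegree (GaloisField p n) d,
      Complex.exp ((t * (scale p r n * (N p r n d f - mean p r n)) : ℝ) * Complex.I)) -
      Complex.exp ((-(t ^ 2 * (weight p r n * v) / 2) : ℝ))‖ ≤
      4 * (|t| / S) ^ (2 * K) * Real.exp (S ^ 2 * weight p r n) +
        |t| ^ 3 * (scale p r n * r) * weight p r n at key
  have hσ := scale_nonneg p r n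
  have b1 : 4 * (|t| / S) ^ (2 * K) * Real.exp (S ^ 2 * weight p r n) < ε / 3 := by
    refine lt_of_le_of_lt ?_ hK
    have hM : Real.exp (S ^ 2 * weight p r n) ≤ M :=
      Real.exp_le_exp.2 (mul_le_mul_of_nonneg_left (hweight n hn0) (sq_nonneg S))
    gcongr
  have b2 : |t| ^ 3 * (scale p r n * r) * weight p r n < ε / 3 := by
    refine lt_of_le_of_lt ?_ he
    exact mul_le_mul_of_nonneg_left (hweight n hn0) (by positivity)
  rw [← dist_eq_norm] at key
  have h3 := (dist_triangle _ _ _).trans_lt (add_lt_add_of_le_of_lt key hw)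
  linarith

/-- Gaussian fluctuations about any centering close to the mean. -/
theorem tendstoInDistribution_N (β : ℕ → ℝ)
    (hβ : Tendsto (fun n => scale p r n * (mean p r n - β n)) atTop (𝓝 0)) :
    TendstoInDistribution
      (fun (i : ℕ × ℕ) (f : MonicOfDegree (GaloisField p i.1) i.2) =>
        scale p r i.1 * (N p r i.1 i.2 f - β i.1))
      (atTop ×ˢ (atTop ⊓ 𝓟 {d : ℕ | d.Coprime p})) (id : ℝ → ℝ)
      (fun i : ℕ × ℕ => uniform p i.1 i.2) (gaussianReal 0 1) := by
  refine tendstoInDistribution_of_charFun (fun i => Measurable.of_discrete) fun t => ?_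
  -- Changing the centring multiplies the characteristic function by a phase that tends to one.
  have h1 : Tendsto (fun i : ℕ × ℕ =>
      Complex.exp ((t * (scale p r i.1 * (mean p r i.1 - β i.1)) : ℝ) * Complex.I))
      (atTop ×ˢ (atTop ⊓ 𝓟 {d : ℕ | d.Coprime p})) (𝓝 1) := by
    have hc : Continuous fun x : ℝ => Complex.exp ((t * x : ℝ) * Complex.I) := by fun_prop
    have h := (hc.tendsto 0).comp (hβ.comp (tendsto_fst (g := atTop ⊓ 𝓟 {d : ℕ | d.Coprime p})))
    rw [mul_zero, Complex.ofReal_zero, zero_mul, Complex.exp_zero] at h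
    exact h
  have h2 := (tendsto_expect_exp p r t).mul h1
  rw [mul_one] at h2
  refine h2.congr fun i => ?_
  rw [uniform, charFun_map_uniformOn_univ, Finset.expect_mul]
  refine Finset.expect_congr rfl fun f _ => ?_
  rw [← Complex.exp_add]
  congr 1
  push_cast
  ring

theorem scale_two (r n : ℕ) :
    scale 2 r n = 2 * (r : ℝ) ^ (-1 / 2 : ℝ) * (((2 : ℕ) : ℝ) ^ n) ^ (-(r : ℝ) / 2) := by
  have h : ((2 : ℕ) : ℝ) ^ (1 / 2 : ℝ) * ((1 - 1 / ((2 : ℕ) : ℝ)) * r) ^ (-1 / 2 : ℝ) =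
      2 * (r : ℝ) ^ (-1 / 2 : ℝ) := by
    have e : (1 - 1 / ((2 : ℕ) : ℝ)) = (2 : ℝ)⁻¹ := by norm_num
    rw [e, Real.mul_rpow (by norm_num) (Nat.cast_nonneg _), ← mul_assoc,
      Real.inv_rpow (by norm_num), ← Real.rpow_neg (by norm_num), Nat.cast_ofNat,
      ← Real.rpow_add (by norm_num)]
    norm_num
  rw [scale, h]

end Limit

end ArtinSchreier

end

theorem theorem7 (p r : ℕ) [Fact p.Prime] [NeZero r] :
    ((r.Coprime p ∨ 2 < p) →
      TendstoInDistribution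
        (fun (i : ℕ × ℕ) (f : ArtinSchreier.MonicOfDegree (GaloisField p i.1) i.2) =>
          (p : ℝ) ^ (1 / 2 : ℝ) * ((1 - 1 / (p : ℝ)) * r) ^ (-1 / 2 : ℝ) *
            ((p : ℝ) ^ i.1) ^ (-(r : ℝ) / 2) *
            (ArtinSchreier.N p r i.1 i.2 f - ((p : ℝ) ^ i.1) ^ r / p))
        (atTop ×ˢ (atTop ⊓ 𝓟 {d : ℕ | d.Coprime p}))
        (id : ℝ → ℝ)
        (fun i : ℕ × ℕ => ArtinSchreier.uniform p i.1 i.2)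
        (gaussianReal 0 1)) ∧
    (p = 2 ∧ Even r →
      TendstoInDistribution
        (fun (i : ℕ × ℕ) (f : ArtinSchreier.MonicOfDegree (GaloisField p i.1) i.2) =>
          2 * (r : ℝ) ^ (-1 / 2 : ℝ) * ((p : ℝ) ^ i.1) ^ (-(r : ℝ) / 2) *
            (ArtinSchreier.N p r i.1 i.2 f - ((p : ℝ) ^ i.1) ^ r / p
              - ((p : ℝ) ^ i.1) ^ ((r : ℝ) / 2) / 2))
        (atTop ×ˢ (atTop ⊓ 𝓟 {d : ℕ | d.Coprime p}))
        (id : ℝ → ℝ)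
        (fun i : ℕ × ℕ => ArtinSchreier.uniform p i.1 i.2)
        (gaussianReal 0 1)) := by
  refine ⟨fun h => ?_, fun h => ?_⟩
  · refine ArtinSchreier.tendstoInDistribution_N p r (fun n => ((p : ℝ) ^ n) ^ r / p) ?_
    by_cases hc : r.Coprime p
    · refine tendsto_const_nhds.congr fun n => ?_
      rw [ArtinSchreier.mean, ArtinSchreier.degenerateCount_eq_zero
        (by rwa [ArtinSchreier.finrank_extension_galoisField]) Fact.out]
      simp
    · have hp2 := h.resolve_left hc
      obtain ⟨k, rfl⟩ : p ∣ r :=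
        (Nat.Prime.coprime_iff_not_dvd Fact.out).not_left.1 fun h => hc h.symm
      -- There are `q ^ k` degenerate points, with `k = r / p`. Since `p > 2` gives `2 * k < r`,
      -- their contribution is negligible at scale `q ^ (r / 2)`.
      have hk : k ≠ 0 := right_ne_zero_of_mul (NeZero.ne (p * k))
      have h1 := (ArtinSchreier.tendsto_scale_mul_pow p (p * k) (k := k)
        (Nat.mul_lt_mul_of_pos_right hp2 (Nat.pos_of_ne_zero hk))).mul_const (1 - 1 / (p : ℝ))
      rw [zero_mul] at h1
      refine h1.congr' ?_
      filter_upwards [eventually_ne_atTop 0] with n hn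
      rw [ArtinSchreier.mean, ArtinSchreier.degenerateCount_eq hk
        (ArtinSchreier.finrank_extension_galoisField p (p * k) n), GaloisField.card p n hn]
      push_cast
      ring
  · obtain ⟨rfl, k, hk⟩ := h
    have hk0 : k ≠ 0 := by
      rintro rfl
      exact NeZero.ne r hk
    have key := ArtinSchreier.tendstoInDistribution_N 2 r
      (fun n => (((2 : ℕ) : ℝ) ^ n) ^ r / ((2 : ℕ) : ℝ) +
        (((2 : ℕ) : ℝ) ^ n) ^ ((r : ℝ) / 2) / 2) (by
        -- For `p = 2` and `n ≠ 0` the centring is the exact mean: the `q ^ (r / 2)` degenerate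
        -- points each contribute `1 - 1 / 2`.
        refine tendsto_const_nhds.congr' ?_
        filter_upwards [eventually_ne_atTop 0] with n hn
        have e : (((2 : ℕ) : ℝ) ^ n) ^ ((r : ℝ) / 2) = (((2 : ℕ) : ℝ) ^ n) ^ k := by
          rw [← Real.rpow_natCast _ k, hk]
          congr 1
          push_cast
          ring
        rw [e, ArtinSchreier.mean, ArtinSchreier.degenerateCount_eq hk0
          (by rw [ArtinSchreier.finrank_extension_galoisField, hk, two_mul]),
          GaloisField.card 2 n hn]
        push_cast
        ring)
    simp only [ArtinSchreier.scale_two] at key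
    simpa only [sub_sub] using key
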